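/- Let $x\in\mathbb{R}^{D_0}$, $y\in\mathbb{R}^{D_2}$ be random vectors with finite second moments on a common probability space. Write $\mathbb{E}(xx^\top)=P_A\Phi P_A^\top$ and $\mathbb{E}(yy^\top)=P_B\Psi P_B^\top$, where $P_A\in\mathbb{R}^{D_0\times d_0}$, $P_B\in\mathbb{R}^{D_2\times d_2}$ have orthonormal columns and $\Phi,\Psi$ are diagonal with positive diagonal entries. Put $\tilde x=\Phi^{-1/2}P_A^\top x$, $\tilde y=\Psi^{-1/2}P_B^\top y$, $Z=\mathbb{E}(\tilde x\tilde y^\top)\in\mathbb{R}^{d_0\times d_2}$, $D=P_B\Psi^{1/2}$ and $E=D(I-Z^\top Z)D^\top=P_B\Psi^{1/2}(I-Z^\top Z)\Psi^{1/2}P_B^\top$. Let $\beta,\eta_{\rm enc},\eta_{\rm dec}>0$ and $c=\eta_{\rm dec}/\eta_{\rm enc}$. For $U_1\in\mathbb{R}^{D_2\times d_1}$, $V_1\in\mathbb{R}^{d_1\times d_0}$, $V_2\in\mathbb{R}^{d_1\times d_2}$, $T_2\in\mathbb{R}^{D_2\times d_0}$ and symmetric positive definite $\Sigma\in\mathbb{R}^{d_1\times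 d_1}$ let $$\mathcal L(U_1,V_1,V_2,T_2,\Sigma)=\frac1{\eta_{\rm dec}^2}\Big[\|U_1V_1+T_2\|_F^2+\|U_1V_2-D\|_F^2+2\operatorname{tr}\big((U_1V_2-D)^\top(U_1V_1+T_2)Z\big)+\operatorname{tr}\big((U_1^\top U_1+\beta c^2I)\Sigma\big)+\beta c^2\big(\|V_1\|_F^2+\|V_2\|_F^2+2\operatorname{tr}(V_1ZV_2^\top)\big)\Big]-\beta\log|\Sigma|.$$ The matrix $E$ has an eigenvalue decomposition $E=P_E\Theta P_E^\top$ with $P_E\in\mathbb{R}^{D_2\times D_2}$ orthogonal and $\Theta=\operatorname{diag}(\theta_1,\dots,\theta_{D_2})$, $\theta_1\ge\dots\ge\theta_{D_2}$. Moreover $s:=\operatorname{rank}E\le d_2$, all $\theta_i\ge0$, and $\theta_i>0$ exactly for $i\le s$. Put $\theta_i=0$ for $D_2<i\le d_1$. Global minimizers of $\mathcal L$ exist, and $(U_1^*,V_1^*,V_2^*,T_2^*,\Sigma^*)$ is one if and only if $$U_1^*=P_E\,\Omega\,R^\top,\qquad T_2^*=P_B\Psi^{1/2}Z^\top,\qquad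 \Sigma^*=\beta\eta_{\rm dec}^2\,(U_1^{*\top}U_1^*+\beta c^2I)^{-1},$$ $$V_2^*(I-Z^\top Z)=(U_1^{*\top}U_1^*+\beta c^2I)^{-1}U_1^{*\top}P_B\Psi^{1/2}(I-Z^\top Z),\qquad V_1^*=-V_2^*Z^\top$$ for some non-increasing eigenvalue decomposition $E=P_E\Theta P_E^\top$ as above and some orthogonal $R\in\mathbb{R}^{d_1\times d_1}$, where $\Omega\in\mathbb{R}^{D_2\times d_1}$ is the rectangular diagonal matrix with diagonal entries $$\omega_i=\frac1{\eta_{\rm enc}}\sqrt{\max(0,\theta_i-\beta\eta_{\rm dec}^2)}.$$ In particular, at every global minimizer, $\operatorname{rank}U_1^*=\#\{i\in\{1,\dots,d_1\}:\theta_i>\beta\eta_{\rm dec}^2\}$. If at a global minimizer $\Sigma^*=\operatorname{diag}(\sigma_1^2,\dots,\sigma_{d_1}^2)$ is diagonal, with all $\sigma_i\ge0$, then $(\sigma_i)_{i=1}^{d_1}$ is a permutation of $(\sigma_i')_{i=1}^{d_1}$, where $$\sigma_i'=\begin{cases}\sqrt\beta\,\eta_{\rm enc}\eta_{\rm dec}/\sqrt{\theta_i}&\text{if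 }\theta_i\ge\beta\eta_{\rm dec}^2,\\ \eta_{\rm enc}&\text{if }\theta_i<\beta\eta_{\rm dec}^2,\end{cases}$$ and $U_1^*$ has exactly $d_1-\operatorname{rank}U_1^*$ zero columns (collapsed latent dimensions). -/

import Mathlib

open MeasureTheory Matrix

noncomputable section

namespace LinearCVAE

/-- The matrix `E(u vᵀ)` of mixed second moments of two random vectors. -/
def crossMoment {S : Type*} [MeasurableSpace S] (μ : Measure S) {m n : ℕ}
    (u : S → Fin m → ℝ) (v : S → Fin n → ℝ) : Matrix (Fin m) (Fin n) ℝ :=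
  Matrix.of fun i j => ∫ s, u s i * v s j ∂μ

/-- `M = P diag(φ) Pᵀ`, where the columns of `P` are orthonormal and all entries of `φ` are
positive: the eigenvalue decomposition of `M` restricted to its positive eigenvalues. -/
def IsReducedEigenDecomp {N d : ℕ} (M : Matrix (Fin N) (Fin N) ℝ)
    (P : Matrix (Fin N) (Fin d) ℝ) (φ : Fin d → ℝ) : Prop :=
  Pᵀ * P = 1 ∧ (∀ i, 0 < φ i) ∧ M = P * Matrix.diagonal φ * Pᵀ

/-- `E = P diag(θ) Pᵀ` with `P` orthogonal (square) and `θ` non-increasing. -/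
def IsOrderedEigenDecomp {N : ℕ} (E : Matrix (Fin N) (Fin N) ℝ)
    (P : Matrix (Fin N) (Fin N) ℝ) (θ : Fin N → ℝ) : Prop :=
  P ∈ Matrix.orthogonalGroup (Fin N) ℝ ∧ Antitone θ ∧ E = P * Matrix.diagonal θ * Pᵀ

/-- The whitened random vector `Φ^{-1/2} Pᵀ x`, where `Φ = diag(φ)`. -/
def whiten {S : Type*} {N d : ℕ} (P : Matrix (Fin N) (Fin d) ℝ) (φ : Fin d → ℝ)
    (x : S → Fin N → ℝ) : S → Fin d → ℝ :=
  fun s => (Matrix.diagonal (fun i => (√(φ i))⁻¹) * Pᵀ) *ᵥ x s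

/-- The matrix `P Ψ^{1/2}`, where `Ψ = diag(ψ)`. -/
def scaledBasis {N d : ℕ} (P : Matrix (Fin N) (Fin d) ℝ) (ψ : Fin d → ℝ) :
    Matrix (Fin N) (Fin d) ℝ :=
  P * Matrix.diagonal (fun i => √(ψ i))

/-- The squared Frobenius norm. -/
def frobSq {m n : ℕ} (M : Matrix (Fin m) (Fin n) ℝ) : ℝ := ∑ i, ∑ j, M i j ^ 2

/-- The whitened objective of the linear conditional VAE; `c = ηdec / ηenc`. -/
def loss {D2 d0 d1 d2 : ℕ} (β ηenc ηdec : ℝ)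
    (D : Matrix (Fin D2) (Fin d2) ℝ) (Z : Matrix (Fin d0) (Fin d2) ℝ)
    (U1 : Matrix (Fin D2) (Fin d1) ℝ) (V1 : Matrix (Fin d1) (Fin d0) ℝ)
    (V2 : Matrix (Fin d1) (Fin d2) ℝ) (T2 : Matrix (Fin D2) (Fin d0) ℝ)
    (Sig : Matrix (Fin d1) (Fin d1) ℝ) : ℝ :=
  1 / ηdec ^ 2 *
      (frobSq (U1 * V1 + T2) + frobSq (U1 * V2 - D)
        + 2 * Matrix.trace ((U1 * V2 - D)ᵀ * (U1 * V1 + T2) * Z)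
        + Matrix.trace ((U1ᵀ * U1 + (β * (ηdec / ηenc) ^ 2) • 1) * Sig)
        + β * (ηdec / ηenc) ^ 2 *
            (frobSq V1 + frobSq V2 + 2 * Matrix.trace (V1 * Z * V2ᵀ)))
    - β * Real.log Sig.det

/-- Global minimizers of `loss` over all parameter matrices `U1, V1, V2, T2` and all symmetric
positive definite encoder variances. -/
def IsGlobalMinimizer {D2 d0 d1 d2 : ℕ} (β ηenc ηdec : ℝ)
    (D : Matrix (Fin D2) (Fin d2) ℝ) (Z : Matrix (Fin d0) (Fin d2) ℝ)
    (U1 : Matrix (Fin D2) (Fin d1) ℝ) (V1 : Matrix (Fin d1) (Fin d0) ℝ)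
    (V2 : Matrix (Fin d1) (Fin d2) ℝ) (T2 : Matrix (Fin D2) (Fin d0) ℝ)
    (Sig : Matrix (Fin d1) (Fin d1) ℝ) : Prop :=
  Sig.PosDef ∧
    ∀ (U1' : Matrix (Fin D2) (Fin d1) ℝ) (V1' : Matrix (Fin d1) (Fin d0) ℝ)
      (V2' : Matrix (Fin d1) (Fin d2) ℝ) (T2' : Matrix (Fin D2) (Fin d0) ℝ)
      (Sig' : Matrix (Fin d1) (Fin d1) ℝ), Sig'.PosDef →
      loss β ηenc ηdec D Z U1 V1 V2 T2 Sig ≤ loss β ηenc ηdec D Z U1' V1' V2' T2' Sig'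

/-- A finite sequence, continued by zeros. -/
def extend {N : ℕ} (θ : Fin N → ℝ) (i : ℕ) : ℝ := if h : i < N then θ ⟨i, h⟩ else 0

/-- The optimal singular value that belongs to the eigenvalue `t`. -/
def omega (β ηenc ηdec t : ℝ) : ℝ := 1 / ηenc * √(max 0 (t - β * ηdec ^ 2))

/-- The rectangular diagonal matrix with the optimal singular values on its diagonal. -/
def Omega {D2 : ℕ} (d1 : ℕ) (β ηenc ηdec : ℝ) (θ : Fin D2 → ℝ) :
    Matrix (Fin D2) (Fin d1) ℝ :=
  Matrix.of fun i j => if (i : ℕ) = j then omega β ηenc ηdec (extend θ j) else 0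

/-- The optimal encoder standard deviation that belongs to the eigenvalue `t`. -/
def sigma (β ηenc ηdec t : ℝ) : ℝ :=
  if β * ηdec ^ 2 ≤ t then √β * ηenc * ηdec / √t else ηenc

end LinearCVAE

end

/-! Put κ = β ηdec² and l = β c², and multiply the loss by ηdec². The whitened `y` splits into its
regression Zᵀx̃ and a residual uncorrelated with x̃, of second moment I − ZᵀZ = N Nᵀ. Accordingly
each of the two quadratic forms splits into two squares (`frobSq_pair`). The squares without N
vanish together exactly when V1 = −V2 Zᵀ and T2 = D Zᵀ. What is left in V2 is a ridge regression of
D N on U1 (`frobSq_ridge`), and Σ is settled by log det X ≤ tr X − n (`trace_sub_log_det_ge`). For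
every U = U1 these optima are attained together and leave tr(E(I − U(UᵀU + lI)⁻¹Uᵀ)) + κ log det(UᵀU
+ lI), which is `reduced`.

Let θ and b be the eigenvalues of E and UUᵀ. The squared overlaps of the two eigenbases are doubly
stochastic weights, and `reduced` is a constant minus a weighted sum of scalar gains in (θ_i, b_j)
(`reduced_eq`). Each gain has a unique maximizer, the ω² of the theorem. At most d1 of the b_j are
nonzero, so the total is at most the sum of the maximal gains of the d1 largest θ_i (`sum_gain_le`).

In case of equality a nonzero b_j determines every θ_i whose eigenvector it overlaps, so E and UUᵀ
commute (`commute_of_reduced_eq`). In a common eigenbasis sorted lexicographically an exchange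
argument pins down b (`eq_of_sum_gain_eq`), and UUᵀ determines U up to an orthogonal factor on the
right (`exists_orth_of_mul_transpose`). Rank, spectrum of Σ and zero columns are read off from UᵀU.
-/

noncomputable section

namespace LinearCVAE

/-! ### Orthogonal diagonalization -/

/-- `A = P diag(a) Pᵀ` with `P` orthogonal. -/
def IsOrthDiag {N : ℕ} (A P : Matrix (Fin N) (Fin N) ℝ) (a : Fin N → ℝ) : Prop :=
  P ∈ Matrix.orthogonalGroup (Fin N) ℝ ∧ A = P * Matrix.diagonal a * Pᵀ

theorem orth_transpose_mul {N : ℕ} {P : Matrix (Fin N) (Fin N) ℝ}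
    (hP : P ∈ Matrix.orthogonalGroup (Fin N) ℝ) : Pᵀ * P = 1 := by
  have := (Matrix.mem_orthogonalGroup_iff' (Fin N) ℝ).1 hP
  simpa [star_eq_conjTranspose] using this

theorem orth_mul_transpose {N : ℕ} {P : Matrix (Fin N) (Fin N) ℝ}
    (hP : P ∈ Matrix.orthogonalGroup (Fin N) ℝ) : P * Pᵀ = 1 := by
  have := (Matrix.mem_orthogonalGroup_iff (Fin N) ℝ).1 hP
  simpa [star_eq_conjTranspose] using this

theorem mem_orth_of_transpose_mul {N : ℕ} {P : Matrix (Fin N) (Fin N) ℝ}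
    (hP : Pᵀ * P = 1) : P ∈ Matrix.orthogonalGroup (Fin N) ℝ := by
  rw [Matrix.mem_orthogonalGroup_iff']
  simpa [star_eq_conjTranspose] using hP

theorem orth_transpose_mem {N : ℕ} {P : Matrix (Fin N) (Fin N) ℝ}
    (hP : P ∈ Matrix.orthogonalGroup (Fin N) ℝ) : Pᵀ ∈ Matrix.orthogonalGroup (Fin N) ℝ :=
  mem_orth_of_transpose_mul (by rw [transpose_transpose]; exact orth_mul_transpose hP)

theorem orth_mul_cancel {N m : ℕ} {P : Matrix (Fin N) (Fin N) ℝ}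
    (hP : P ∈ Matrix.orthogonalGroup (Fin N) ℝ) (X : Matrix (Fin N) (Fin m) ℝ) :
    P * (Pᵀ * X) = X := by
  rw [← Matrix.mul_assoc, orth_mul_transpose hP, Matrix.one_mul]

theorem orth_transpose_mul_cancel {N m : ℕ} {P : Matrix (Fin N) (Fin N) ℝ}
    (hP : P ∈ Matrix.orthogonalGroup (Fin N) ℝ) (X : Matrix (Fin N) (Fin m) ℝ) :
    Pᵀ * (P * X) = X := by
  rw [← Matrix.mul_assoc, orth_transpose_mul hP, Matrix.one_mul]

theorem IsOrthDiag.mul_eq {N : ℕ} {A P : Matrix (Fin N) (Fin N) ℝ} {a : Fin N → ℝ}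
    (h : IsOrthDiag A P a) : A * P = P * diagonal a := by
  rw [h.2, Matrix.mul_assoc, orth_transpose_mul h.1, Matrix.mul_one]

theorem isOrthDiag_of_mul_eq {N : ℕ} {A P : Matrix (Fin N) (Fin N) ℝ} {a : Fin N → ℝ}
    (hP : P ∈ Matrix.orthogonalGroup (Fin N) ℝ) (h : A * P = P * diagonal a) :
    IsOrthDiag A P a :=
  ⟨hP, by rw [← h, Matrix.mul_assoc, orth_mul_transpose hP, Matrix.mul_one]⟩

theorem IsOrthDiag.charpoly {N : ℕ} {A P : Matrix (Fin N) (Fin N) ℝ} {a : Fin N → ℝ}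
    (h : IsOrthDiag A P a) : A.charpoly = (diagonal a).charpoly := by
  rw [h.2, Matrix.mul_assoc, Matrix.charpoly_mul_comm, Matrix.mul_assoc, orth_transpose_mul h.1,
    Matrix.mul_one]

theorem IsOrthDiag.det {N : ℕ} {A P : Matrix (Fin N) (Fin N) ℝ} {a : Fin N → ℝ}
    (h : IsOrthDiag A P a) : A.det = ∏ i, a i := by
  rw [h.2, Matrix.mul_assoc, Matrix.det_mul_comm, Matrix.mul_assoc, orth_transpose_mul h.1,
    Matrix.mul_one, det_diagonal]

theorem IsOrthDiag.trace {N : ℕ} {A P : Matrix (Fin N) (Fin N) ℝ} {a : Fin N → ℝ}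
    (h : IsOrthDiag A P a) : A.trace = ∑ i, a i := by
  rw [h.2, Matrix.mul_assoc, Matrix.trace_mul_comm, Matrix.mul_assoc, orth_transpose_mul h.1,
    Matrix.mul_one, trace_diagonal]

theorem isUnit_det_of_mem_orth {N : ℕ} {P : Matrix (Fin N) (Fin N) ℝ}
    (hP : P ∈ Matrix.orthogonalGroup (Fin N) ℝ) : IsUnit P.det :=
  Matrix.isUnit_det_of_left_inverse (orth_transpose_mul hP)

theorem IsOrthDiag.rank {N : ℕ} {A P : Matrix (Fin N) (Fin N) ℝ} {a : Fin N → ℝ}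
    (h : IsOrthDiag A P a) : A.rank = {i | a i ≠ 0}.ncard := by
  rw [h.2, Matrix.rank_mul_eq_left_of_isUnit_det _ _
      (isUnit_det_of_mem_orth (orth_transpose_mem h.1)),
    Matrix.rank_mul_eq_right_of_isUnit_det _ _ (isUnit_det_of_mem_orth h.1),
    Matrix.rank_diagonal, ← Nat.card_coe_set_eq, Nat.card_eq_fintype_card]
  rfl

/-- Both diagonals have the characteristic polynomial of `A`, hence the same multiset of roots. The
fibres of `a` and `b` over each value then have equal size and can be matched. -/
theorem IsOrthDiag.exists_perm {N : ℕ} {A P Q : Matrix (Fin N) (Fin N) ℝ} {a b : Fin N → ℝ}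
    (h : IsOrthDiag A P a) (h' : IsOrthDiag A Q b) : ∃ π : Equiv.Perm (Fin N), a ∘ π = b := by
  have h1 : (diagonal a).charpoly = (diagonal b).charpoly := by rw [← h.charpoly, h'.charpoly]
  have hroots : ∀ c : Fin N → ℝ, (diagonal c).charpoly.roots = Finset.univ.val.map c := by
    intro c
    rw [Matrix.charpoly_diagonal, ← Polynomial.roots_multiset_prod_X_sub_C (Finset.univ.val.map c),
      Multiset.map_map]
    rfl
  have h2 : Finset.univ.val.map a = Finset.univ.val.map b := by rw [← hroots, h1, hroots]
  have h3 : ∀ t, Nonempty ({i // b i = t} ≃ {i // a i = t}) := by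
    intro t
    have := congrArg (Multiset.count t) h2
    simp only [Multiset.count_map] at this
    refine ⟨Fintype.equivOfCardEq ?_⟩
    simp only [Fintype.card_subtype, Finset.card_def, Finset.filter_val, eq_comm (b := t)]
    exact this.symm
  exact ⟨Equiv.ofFiberEquiv fun t => (h3 t).some, funext fun i => Equiv.ofFiberEquiv_map _ i⟩

theorem IsOrthDiag.perm {N : ℕ} {A P : Matrix (Fin N) (Fin N) ℝ} {a : Fin N → ℝ}
    (h : IsOrthDiag A P a) (π : Equiv.Perm (Fin N)) :
    IsOrthDiag A (P.submatrix id π) (a ∘ π) := by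
  have hd : diagonal (a ∘ π) = (diagonal a).submatrix π π :=
    (submatrix_diagonal_equiv a π).symm
  constructor
  · apply mem_orth_of_transpose_mul
    rw [transpose_submatrix, ← submatrix_mul _ _ _ id _ Function.bijective_id,
      orth_transpose_mul h.1, submatrix_one_equiv]
  · rw [hd, transpose_submatrix, submatrix_mul_equiv, submatrix_mul_equiv, ← h.2, submatrix_id_id]

theorem antitone_eq_of_perm {N : ℕ} {α : Type*} [LinearOrder α] {a b : Fin N → α}
    (ha : Antitone a) (hb : Antitone b) (π : Equiv.Perm (Fin N)) (h : a ∘ π = b) : a = b := by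
  have := Tuple.unique_monotone (f := OrderDual.toDual ∘ a) (σ := 1) (τ := π)
    (fun i j hij => ha hij) (by
      intro i j hij
      have := hb hij
      rw [← h] at this
      exact this)
  have h2 : a = a ∘ π := this
  rw [← h, ← h2]

/-- The value type is general because pairs in lexicographic order are sorted later. -/
theorem exists_perm_antitone {N : ℕ} {α : Type*} [LinearOrder α] (a : Fin N → α) :
    ∃ π : Equiv.Perm (Fin N), Antitone (a ∘ π) :=
  ⟨Tuple.sort (OrderDual.toDual ∘ a), fun _ _ hij => Tuple.monotone_sort (OrderDual.toDual ∘ a) hij⟩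

theorem IsOrderedEigenDecomp.isOrthDiag {N : ℕ} {E P : Matrix (Fin N) (Fin N) ℝ} {θ : Fin N → ℝ}
    (h : IsOrderedEigenDecomp E P θ) : IsOrthDiag E P θ := ⟨h.1, h.2.2⟩

theorem IsOrderedEigenDecomp.eq_of_isOrthDiag {N : ℕ} {E P Q : Matrix (Fin N) (Fin N) ℝ}
    {θ a : Fin N → ℝ} (h : IsOrderedEigenDecomp E P θ) (h' : IsOrthDiag E Q a)
    (ha : Antitone a) : a = θ := by
  obtain ⟨π, hπ⟩ := h.isOrthDiag.exists_perm h'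
  exact (antitone_eq_of_perm h.2.1 ha π hπ).symm

theorem exists_isOrthDiag {N : ℕ} {A : Matrix (Fin N) (Fin N) ℝ} (hA : A.IsHermitian) :
    ∃ P a, IsOrthDiag A P a := by
  refine ⟨hA.eigenvectorUnitary, hA.eigenvalues, hA.eigenvectorUnitary.2, ?_⟩
  conv_lhs => rw [hA.spectral_theorem]
  simp [Unitary.conjStarAlgAut_apply, star_eq_conjTranspose]

theorem exists_isOrderedEigenDecomp {N : ℕ} {A : Matrix (Fin N) (Fin N) ℝ} (hA : A.IsHermitian) :
    ∃ P θ, IsOrderedEigenDecomp A P θ := by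
  obtain ⟨P, a, h⟩ := exists_isOrthDiag hA
  obtain ⟨π, hπ⟩ := exists_perm_antitone a
  exact ⟨_, _, (h.perm π).1, hπ, (h.perm π).2⟩

/-- Commuting symmetric matrices have a common orthonormal eigenbasis. -/
theorem exists_isOrthDiag_of_commute {N : ℕ} {A B : Matrix (Fin N) (Fin N) ℝ}
    (hA : A.IsHermitian) (hB : B.IsHermitian) (hAB : A * B = B * A) :
    ∃ P a b, IsOrthDiag A P a ∧ IsOrthDiag B P b := by
  classical
  have sA := isSymmetric_toEuclideanLin_iff.mpr hA
  have sB := isSymmetric_toEuclideanLin_iff.mpr hB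
  have hc : Commute (toEuclideanLin A) (toEuclideanLin B) := by
    apply LinearMap.ext
    intro v
    simp [toLpLin_apply, Module.End.mul_apply, mulVec_mulVec, hAB]
  have hfam := sA.orthogonalFamily_eigenspace_inf_eigenspace sB
  have hint := sA.directSum_isInternal_of_commute sB hc
  -- The joint eigenspaces are indexed by all of ℝ × ℝ. Only finitely many are nonzero, and a
  -- subordinate orthonormal basis needs a finite index type.
  have hfin := WellFoundedGT.finite_ne_bot_of_iSupIndep hint.submodule_iSupIndep
  let _ : Fintype {i : ℝ × ℝ // (Module.End.eigenspace (toEuclideanLin A) i.2 ⊓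
      Module.End.eigenspace (toEuclideanLin B) i.1) ≠ ⊥} := hfin.fintype
  have hint' := DirectSum.isInternal_ne_bot_iff.2 hint
  have hfam' := hfam.comp (γ := {i : ℝ × ℝ // (Module.End.eigenspace (toEuclideanLin A) i.2 ⊓
      Module.End.eigenspace (toEuclideanLin B) i.1) ≠ ⊥}) Subtype.val_injective
  have hn : Module.finrank ℝ (EuclideanSpace ℝ (Fin N)) = N := by simp
  let u := hint'.subordinateOrthonormalBasis hn hfam'
  have hu := hint'.subordinateOrthonormalBasis_subordinate hn (hV' := hfam')
  let P : Matrix (Fin N) (Fin N) ℝ :=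
    (EuclideanSpace.basisFun (Fin N) ℝ).toBasis.toMatrix u.toBasis
  have hP : P ∈ Matrix.orthogonalGroup (Fin N) ℝ :=
    (EuclideanSpace.basisFun (Fin N) ℝ).toMatrix_orthonormalBasis_mem_unitary u
  have hPij : ∀ i j, P i j = u j i := fun i j => rfl
  let ix := fun k => hint'.subordinateOrthonormalBasisIndex hn k hfam'
  have key : ∀ (C : Matrix (Fin N) (Fin N) ℝ) (c : Fin N → ℝ),
      (∀ k, toEuclideanLin C (u k) = c k • u k) → IsOrthDiag C P c := by
    intro C c h
    apply isOrthDiag_of_mul_eq hP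
    ext i k
    have := congrArg (fun v : EuclideanSpace ℝ (Fin N) => v i) (h k)
    simp only [toLpLin_apply, PiLp.smul_apply, smul_eq_mul] at this
    rw [mul_diagonal, hPij, mul_comm, ← this]
    rfl
  exact ⟨P, fun k => (ix k).1.2, fun k => (ix k).1.1,
    key A _ fun k => Module.End.mem_eigenspace_iff.1 (Submodule.mem_inf.1 (hu k)).1,
    key B _ fun k => Module.End.mem_eigenspace_iff.1 (Submodule.mem_inf.1 (hu k)).2⟩

/-- A matrix with orthogonal rows, of which the first `d` may be nonzero, is a rectangular diagonal
matrix up to an orthogonal factor. -/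
theorem exists_orth_of_mul_transpose {N d : ℕ} {K : Matrix (Fin N) (Fin d) ℝ} {w : Fin N → ℝ}
    (hw : ∀ i : Fin N, d ≤ i → w i = 0) (hK : K * Kᵀ = diagonal fun i => w i ^ 2) :
    ∃ R ∈ Matrix.orthogonalGroup (Fin d) ℝ,
      K = (Matrix.of fun (i : Fin N) (j : Fin d) => if (i : ℕ) = j then w i else 0) * Rᵀ := by
  classical
  have hrow : ∀ i i', ∑ j, K i j * K i' j = if i = i' then w i ^ 2 else 0 := by
    intro i i'
    have := congrFun (congrFun hK i) i'
    rwa [mul_apply, diagonal_apply] at this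
  -- The nonzero rows of `K`, normalized, become the corresponding columns of `R`; by `hw` they all
  -- have index below `d`. Any orthonormal completion supplies the other columns, and the default 0
  -- lies outside `s`.
  let v : Fin d → EuclideanSpace ℝ (Fin d) := fun j =>
    if h : (j : ℕ) < N then WithLp.toLp 2 fun l => (w ⟨j, h⟩)⁻¹ * K ⟨j, h⟩ l else 0
  let s : Set (Fin d) := {j | ∃ h : (j : ℕ) < N, w ⟨j, h⟩ ≠ 0}
  have hv : Orthonormal ℝ (s.domRestrict v) := by
    rw [orthonormal_iff_ite]
    rintro ⟨i, hi, hwi⟩ ⟨j, hj, hwj⟩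
    have : inner ℝ (v i) (v j) = (w ⟨i, hi⟩)⁻¹ * (w ⟨j, hj⟩)⁻¹ * ∑ l, K ⟨i, hi⟩ l * K ⟨j, hj⟩ l := by
      simp only [v, hi, hj, dif_pos, PiLp.inner_apply, RCLike.inner_apply, conj_trivial,
        Finset.mul_sum]
      exact Finset.sum_congr rfl fun l _ => by ring
    change inner ℝ (v i) (v j) = _
    rw [this, hrow]
    simp only [Subtype.mk.injEq, Fin.mk.injEq, Fin.val_inj]
    split_ifs with h
    · subst h
      field_simp
    · simp
  obtain ⟨b, hb⟩ := hv.exists_orthonormalBasis_extension_of_card_eq (by simp)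
  let R : Matrix (Fin d) (Fin d) ℝ := (EuclideanSpace.basisFun (Fin d) ℝ).toBasis.toMatrix b.toBasis
  have hR : R ∈ Matrix.orthogonalGroup (Fin d) ℝ :=
    (EuclideanSpace.basisFun (Fin d) ℝ).toMatrix_orthonormalBasis_mem_unitary b
  have hRij : ∀ i j, R i j = b j i := fun i j => rfl
  refine ⟨R, hR, ?_⟩
  ext i l
  have hzero : w i = 0 → K i l = 0 := by
    intro h
    have h1 := hrow i i
    rw [if_pos rfl, h, zero_pow two_ne_zero,
      Finset.sum_eq_zero_iff_of_nonneg fun j _ => mul_self_nonneg _] at h1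
    exact mul_self_eq_zero.1 (h1 l (Finset.mem_univ _))
  rw [mul_apply]
  simp only [of_apply, transpose_apply, ite_mul, zero_mul, hRij]
  by_cases hwi : w i = 0
  · simp [hwi, hzero hwi]
  · have hid : (i : ℕ) < d := by
      by_contra h
      exact hwi (hw i (not_lt.1 h))
    rw [Finset.sum_eq_single (⟨i, hid⟩ : Fin d)]
    · have hs : (⟨i, hid⟩ : Fin d) ∈ s := ⟨i.2, hwi⟩
      rw [hb _ hs]
      simp [v, hwi]
    · intro j _ hj
      rw [if_neg]
      intro h
      exact hj (Fin.ext h.symm)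
    · simp

/-- For a positive definite matrix, `log det X ≤ tr X - n`, with equality only at the identity. -/
theorem log_det_le_trace {n : ℕ} {X : Matrix (Fin n) (Fin n) ℝ} (hX : X.PosDef) :
    Real.log X.det ≤ X.trace - n ∧ (Real.log X.det = X.trace - n → X = 1) := by
  obtain ⟨P, a, h⟩ : ∃ P a, IsOrthDiag X P a ∧ ∀ i, 0 < a i := by
    refine ⟨hX.1.eigenvectorUnitary, hX.1.eigenvalues, ⟨hX.1.eigenvectorUnitary.2, ?_⟩,
      fun i => hX.eigenvalues_pos i⟩
    conv_lhs => rw [hX.1.spectral_theorem]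
    simp [Unitary.conjStarAlgAut_apply, star_eq_conjTranspose]
  have h1 : Real.log X.det = ∑ i, Real.log (a i) := by
    rw [h.1.det, Real.log_prod fun i _ => (h.2 i).ne']
  have h2 : X.trace - n = ∑ i, (a i - 1) := by
    rw [h.1.trace]
    simp
  have h3 : ∀ i ∈ Finset.univ, Real.log (a i) ≤ a i - 1 := fun i _ =>
    Real.log_le_sub_one_of_pos (h.2 i)
  rw [h1, h2]
  refine ⟨Finset.sum_le_sum h3, fun heq => ?_⟩
  have h4 := (Finset.sum_eq_sum_iff_of_le h3).1 heq
  have h5 : a = 1 := by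
    funext i
    by_contra hne
    exact (Real.log_lt_sub_one_of_pos (h.2 i) hne).ne (h4 i (Finset.mem_univ _))
  rw [h.1.2, h5]
  simp [orth_mul_transpose h.1.1]

theorem frobSq_eq_trace {m n : ℕ} (M : Matrix (Fin m) (Fin n) ℝ) : frobSq M = (Mᵀ * M).trace := by
  simp only [frobSq, trace, diag_apply, mul_apply, transpose_apply]
  rw [Finset.sum_comm]
  exact Finset.sum_congr rfl fun i _ => Finset.sum_congr rfl fun j _ => by ring

theorem frobSq_nonneg {m n : ℕ} (M : Matrix (Fin m) (Fin n) ℝ) : 0 ≤ frobSq M :=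
  Finset.sum_nonneg fun _ _ => Finset.sum_nonneg fun _ _ => sq_nonneg _

theorem frobSq_eq_zero {m n : ℕ} {M : Matrix (Fin m) (Fin n) ℝ} (h : frobSq M = 0) : M = 0 := by
  ext i j
  have h1 := (Finset.sum_eq_zero_iff_of_nonneg fun i _ =>
    Finset.sum_nonneg fun j _ => sq_nonneg (M i j)).1 h i (Finset.mem_univ _)
  have h2 := (Finset.sum_eq_zero_iff_of_nonneg fun j _ => sq_nonneg (M i j)).1 h1 j
    (Finset.mem_univ _)
  simpa using h2

/-! ### The scalar problem -/

/-- The decrease of the reduced objective due to a squared singular value `b` aligned with an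
eigenvalue `t`. -/
def gain (κ l t b : ℝ) : ℝ := t - l * t / (b + l) - κ * Real.log ((b + l) / l)

/-- The maximal value of `gain κ l t` on `[0, ∞)`. -/
def maxGain (κ t : ℝ) : ℝ := if κ < t then t - κ - κ * Real.log (t / κ) else 0

/-- The maximizer of `gain κ l t` on `[0, ∞)`. -/
def gainArg (κ l t : ℝ) : ℝ := l / κ * max 0 (t - κ)

theorem gain_zero {κ l t : ℝ} (hl : 0 < l) : gain κ l t 0 = 0 := by
  simp [gain, hl.ne']

theorem gainArg_nonneg {κ l t : ℝ} (hκ : 0 < κ) (hl : 0 < l) : 0 ≤ gainArg κ l t :=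
  mul_nonneg (div_pos hl hκ).le (le_max_left _ _)

theorem gainArg_eq_zero {κ l t : ℝ} (ht : t ≤ κ) : gainArg κ l t = 0 := by
  simp [gainArg, max_eq_left (sub_nonpos.2 ht)]

theorem lt_of_gainArg_ne_zero {κ l t : ℝ} (h : gainArg κ l t ≠ 0) : κ < t :=
  not_le.1 fun ht => h (gainArg_eq_zero ht)

theorem eq_of_lt {κ l t : ℝ} (hκ : 0 < κ) (hl : 0 < l) (ht : κ < t) :
    t = κ + κ / l * gainArg κ l t := by
  rw [gainArg, max_eq_right (sub_pos.2 ht).le]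
  field_simp
  ring

theorem gainArg_lt {κ l s t : ℝ} (hκ : 0 < κ) (hl : 0 < l) (hst : s < t) (ht : κ < t) :
    gainArg κ l s < gainArg κ l t := by
  unfold gainArg
  apply mul_lt_mul_of_pos_left _ (div_pos hl hκ)
  rw [max_eq_right (sub_pos.2 ht).le]
  exact max_lt (sub_pos.2 ht) (by linarith)

/-- In the variable u = (b + l)/l ≥ 1 the gain is t(1 − 1/u) − κ log u, free of `l`. -/
theorem gain_eq {κ l t b : ℝ} (hl : 0 < l) (hb : 0 ≤ b) :
    gain κ l t b = t - t / ((b + l) / l) - κ * Real.log ((b + l) / l) := by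
  have : b + l ≠ 0 := by positivity
  rw [gain]
  field_simp

theorem one_le_ratio {l b : ℝ} (hl : 0 < l) (hb : 0 ≤ b) : 1 ≤ (b + l) / l := by
  rw [le_div_iff₀ hl]
  linarith

theorem gain_gainArg {κ l t : ℝ} (hκ : 0 < κ) (hl : 0 < l) :
    gain κ l t (gainArg κ l t) = maxGain κ t := by
  by_cases ht : κ < t
  · have h : (gainArg κ l t + l) / l = t / κ := by
      rw [gainArg, max_eq_right (sub_pos.2 ht).le]
      field_simp
      ring
    have ht0 : t ≠ 0 := (hκ.trans ht).ne'
    rw [gain_eq hl (gainArg_nonneg hκ hl), h, maxGain, if_pos ht]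
    field_simp
  · rw [gainArg_eq_zero (not_lt.1 ht), gain_zero hl, maxGain, if_neg ht]

/-- For t > κ the gap to the maximum is κ(x − 1 − log x) with x = t/(κu). For t ≤ κ the gain is at
most κ(1 − 1/u − log u). Both reduce to the strict inequality log x < x − 1 for x ≠ 1. -/
theorem gain_lt {κ l t b : ℝ} (hκ : 0 < κ) (hl : 0 < l) (hb : 0 ≤ b)
    (hne : b ≠ gainArg κ l t) : gain κ l t b < maxGain κ t := by
  have hu := one_le_ratio hl hb
  rw [gain_eq hl hb]
  have hb' : b = l * ((b + l) / l - 1) := by field_simp; ring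
  generalize (b + l) / l = u at hu hb' ⊢
  have hu0 : 0 < u := by linarith
  by_cases htκ : κ < t
  · have ht0 : 0 < t := hκ.trans htκ
    rw [maxGain, if_pos htκ]
    have h1 : t / κ / u ≠ 1 := by
      intro h
      apply hne
      rw [gainArg, max_eq_right (sub_pos.2 htκ).le, hb']
      have : u = t / κ := by field_simp at h ⊢; linarith
      rw [this]
      field_simp
    have h2 := Real.log_lt_sub_one_of_pos (by positivity) h1
    rw [Real.log_div (by positivity) hu0.ne'] at h2
    have h3 := mul_lt_mul_of_pos_left h2 hκ
    have h4 : κ * (t / κ / u - 1) = t / u - κ := by field_simp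
    rw [h4] at h3
    linarith
  · rw [maxGain, if_neg htκ]
    rw [gainArg_eq_zero (not_lt.1 htκ)] at hne
    have h1 : u⁻¹ ≠ 1 := by
      intro h
      rw [inv_eq_one] at h
      apply hne
      rw [hb', h, sub_self, mul_zero]
    have h2 := Real.log_lt_sub_one_of_pos (inv_pos.2 hu0) h1
    rw [Real.log_inv] at h2
    have h3 : t * (1 - u⁻¹) ≤ κ * (1 - u⁻¹) :=
      mul_le_mul_of_nonneg_right (not_lt.1 htκ) (by linarith [inv_le_one_of_one_le₀ hu])
    have h4 := mul_lt_mul_of_pos_left h2 hκ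
    rw [div_eq_mul_inv]
    linarith

theorem gain_le {κ l t b : ℝ} (hκ : 0 < κ) (hl : 0 < l) (hb : 0 ≤ b) :
    gain κ l t b ≤ maxGain κ t := by
  by_cases h : b = gainArg κ l t
  · rw [h, gain_gainArg hκ hl]
  · exact (gain_lt hκ hl hb h).le

theorem maxGain_nonneg {κ t : ℝ} (hκ : 0 < κ) : 0 ≤ maxGain κ t := by
  rw [← gain_zero (κ := κ) (t := t) one_pos]
  exact gain_le hκ one_pos le_rfl

theorem gain_mono {κ l s t b : ℝ} (hl : 0 < l) (hb : 0 ≤ b) (hst : s ≤ t) :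
    gain κ l s b ≤ gain κ l t b := by
  rw [gain_eq hl hb, gain_eq hl hb]
  have h := inv_le_one_of_one_le₀ (one_le_ratio hl hb)
  have := mul_le_mul_of_nonneg_right hst (sub_nonneg.2 h)
  simp only [div_eq_mul_inv _ ((b + l) / l)]
  linarith

/-- Use the maximizer for `s` as a candidate for `t`. Since `maxGain` does not involve `l`, the
choice l = 1 is harmless. -/
theorem maxGain_mono {κ s t : ℝ} (hκ : 0 < κ) (hst : s ≤ t) :
    maxGain κ s ≤ maxGain κ t := by
  rw [← gain_gainArg hκ one_pos]
  exact (gain_mono one_pos (gainArg_nonneg hκ one_pos) hst).trans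
    (gain_le hκ one_pos (gainArg_nonneg hκ one_pos))

theorem maxGain_strictMono {κ s t : ℝ} (hκ : 0 < κ) (hst : s < t) (ht : κ < t) :
    maxGain κ s < maxGain κ t := by
  rw [← gain_gainArg hκ one_pos]
  exact (gain_mono one_pos (gainArg_nonneg hκ one_pos) hst.le).trans_lt
    (gain_lt hκ one_pos (gainArg_nonneg hκ one_pos)
      (gainArg_lt hκ one_pos hst ht).ne)

/-! ### Allocating at most `d` nonzero eigenvalues -/

/-- A weighted sum of a non-increasing nonnegative sequence, with weights in `[0, 1]` of total mass
at most `d`, is at most the sum of its first `d` terms. -/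
theorem sum_mul_le_sum_first {n d : ℕ} {p δ : Fin n → ℝ} (hδ : Antitone δ) (hδ0 : ∀ i, 0 ≤ δ i)
    (hp0 : ∀ i, 0 ≤ p i) (hp1 : ∀ i, p i ≤ 1) (hp : ∑ i, p i ≤ d) :
    ∑ i, p i * δ i ≤ ∑ i : Fin n, if (i : ℕ) < d then δ i else 0 := by
  by_cases hdn : d < n
  -- The threshold `c` acts as a Lagrange multiplier: `p i` minus the indicator of `i < d` never has
  -- the same sign as `δ i - c`, and unused mass cannot help because `c ≥ 0`.
  · let c := δ ⟨d, hdn⟩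
    have hcard : ∑ i : Fin n, (if (i : ℕ) < d then (1 : ℝ) else 0) = d := by
      rw [Finset.sum_boole, Fin.card_filter_val_lt, min_eq_right hdn.le]
    have h1 : ∀ i : Fin n, (p i - if (i : ℕ) < d then 1 else 0) * (δ i - c) ≤ 0 := by
      intro i
      split_ifs with h
      · exact mul_nonpos_of_nonpos_of_nonneg (by linarith [hp1 i])
          (sub_nonneg.2 (hδ (Fin.le_def.2 h.le)))
      · exact mul_nonpos_of_nonneg_of_nonpos (by linarith [hp0 i])
          (sub_nonpos.2 (hδ (Fin.le_def.2 (not_lt.1 h))))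
    have h2 := Finset.sum_nonpos fun i (_ : i ∈ Finset.univ) => h1 i
    have h3 : ∑ i : Fin n, (p i - if (i : ℕ) < d then 1 else 0) * (δ i - c)
        = ∑ i, p i * δ i - (∑ i : Fin n, if (i : ℕ) < d then δ i else 0)
          - c * (∑ i, p i - d) := by
      rw [← hcard, ← Finset.sum_sub_distrib, ← Finset.sum_sub_distrib, Finset.mul_sum,
        ← Finset.sum_sub_distrib]
      refine Finset.sum_congr rfl fun i _ => ?_
      split_ifs <;> ring
    have h4 : c * (∑ i, p i - d) ≤ 0 :=
      mul_nonpos_of_nonneg_of_nonpos (hδ0 _) (sub_nonpos.2 hp)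
    linarith
  · refine Finset.sum_le_sum fun i _ => ?_
    rw [if_pos (i.2.trans_le (not_lt.1 hdn))]
    exact mul_le_of_le_one_left (hδ0 i) (hp1 i)

/-- The maximal total gain of a matrix of rank at most `d`. -/
def totalGain {n : ℕ} (d : ℕ) (κ : ℝ) (θ : Fin n → ℝ) : ℝ :=
  ∑ i : Fin n, if (i : ℕ) < d then maxGain κ (θ i) else 0

/-- Columns with `b j = 0` contribute nothing. The remaining weights in row `i` sum to some p_i ≤ 1,
and the p_i sum to the number of nonzero `b j`, at most `d`; so `sum_mul_le_sum_first` applies.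
Equality overall forces equality term by term. -/
theorem sum_gain_le {n d : ℕ} {κ l : ℝ} {θ b : Fin n → ℝ} {w : Fin n → Fin n → ℝ}
    (hκ : 0 < κ) (hl : 0 < l) (hθ : Antitone θ) (hb : ∀ j, 0 ≤ b j)
    (hcard : {j | b j ≠ 0}.ncard ≤ d) (hw : ∀ i j, 0 ≤ w i j) (hrow : ∀ i, ∑ j, w i j = 1)
    (hcol : ∀ j, ∑ i, w i j = 1) :
    ∑ i, ∑ j, w i j * gain κ l (θ i) (b j) ≤ totalGain d κ θ ∧
      (∑ i, ∑ j, w i j * gain κ l (θ i) (b j) = totalGain d κ θ →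
        ∀ i j, b j ≠ 0 → w i j ≠ 0 → b j = gainArg κ l (θ i)) := by
  classical
  have hterm : ∀ i j, w i j * gain κ l (θ i) (b j)
      ≤ (if b j ≠ 0 then w i j else 0) * maxGain κ (θ i) := by
    intro i j
    split_ifs with h
    · exact mul_le_mul_of_nonneg_left (gain_le hκ hl (hb j)) (hw i j)
    · rw [not_not.1 h, gain_zero hl, mul_zero, zero_mul]
  have h1 : ∑ i, ∑ j, w i j * gain κ l (θ i) (b j)
      ≤ ∑ i, (∑ j, if b j ≠ 0 then w i j else 0) * maxGain κ (θ i) :=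
    Finset.sum_le_sum fun i _ => by
      rw [Finset.sum_mul]
      exact Finset.sum_le_sum fun j _ => hterm i j
  have h2 : ∑ i, (∑ j, if b j ≠ 0 then w i j else 0) * maxGain κ (θ i) ≤ totalGain d κ θ := by
    refine sum_mul_le_sum_first (fun i j hij => maxGain_mono hκ (hθ hij))
      (fun i => maxGain_nonneg hκ) (fun i => Finset.sum_nonneg fun j _ => ?_)
      (fun i => ?_) ?_
    · split_ifs
      exacts [hw i j, le_rfl]
    · rw [← hrow i]
      refine Finset.sum_le_sum fun j _ => ?_
      split_ifs
      exacts [le_rfl, hw i j]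
    · rw [Finset.sum_comm]
      have : ∀ j, ∑ i, (if b j ≠ 0 then w i j else 0) = if b j ≠ 0 then (1 : ℝ) else 0 := by
        intro j
        split_ifs
        · exact hcol j
        · simp
      rw [Finset.sum_congr rfl fun j _ => this j, Finset.sum_boole]
      rw [Set.ncard_eq_toFinset_card'] at hcard
      simpa using hcard
  refine ⟨h1.trans h2, fun heq i j hbj hwij => ?_⟩
  have h3 := le_antisymm h1 (h2.trans heq.ge)
  simp only [Finset.sum_mul] at h3
  have h4 := (Finset.sum_eq_sum_iff_of_le fun i _ =>
    Finset.sum_le_sum fun j _ => hterm i j).1 h3 i (Finset.mem_univ _)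
  have h5 := (Finset.sum_eq_sum_iff_of_le fun j _ => hterm i j).1 h4 j (Finset.mem_univ _)
  rw [if_pos hbj] at h5
  by_contra hne
  exact (gain_lt hκ hl (hb j) hne).ne (mul_left_cancel₀ hwij h5)

theorem sum_gain_eq {n d : ℕ} {κ l : ℝ} {θ : Fin n → ℝ} (hκ : 0 < κ) (hl : 0 < l) :
    ∑ i : Fin n, gain κ l (θ i) (if (i : ℕ) < d then gainArg κ l (θ i) else 0)
      = totalGain d κ θ := by
  refine Finset.sum_congr rfl fun i _ => ?_
  split_ifs
  exacts [gain_gainArg hκ hl, gain_zero hl]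

/-- An optimal sequence that is sorted within the level sets of `θ` is unique. -/
theorem eq_of_sum_gain_eq {n d : ℕ} {κ l : ℝ} {θ b : Fin n → ℝ} (hκ : 0 < κ) (hl : 0 < l)
    (hθ : Antitone θ) (hb : ∀ j, 0 ≤ b j)
    (hcard : {j | b j ≠ 0}.ncard ≤ d) (hlex : ∀ i j, i ≤ j → θ i = θ j → b j ≤ b i)
    (heq : ∑ i, gain κ l (θ i) (b i) = totalGain d κ θ) :
    b = fun i : Fin n => if (i : ℕ) < d then gainArg κ l (θ i) else 0 := by
  classical
  have hdiag : ∀ c : Fin n → ℝ, ∑ i, ∑ j, (if i = j then (1 : ℝ) else 0) * gain κ l (θ i) (c j)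
      = ∑ i, gain κ l (θ i) (c i) := fun c => by simp
  have H := fun (c : Fin n → ℝ) (hc : ∀ j, 0 ≤ c j) (hcc : {j | c j ≠ 0}.ncard ≤ d) =>
    sum_gain_le (w := fun i j => if i = j then 1 else 0) hκ hl hθ hc hcc
      (fun i j => by split_ifs <;> simp) (by simp) (by simp)
  simp only [hdiag] at H
  have harg : ∀ i, b i ≠ 0 → b i = gainArg κ l (θ i) := fun i hi =>
    (H b hb hcard).2 heq i i hi (by simp)
  -- Exchange argument: if `b i = 0`, the sorting `hlex` excludes `θ i = θ j`, so moving the nonzero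
  -- value from `j` to `i` and adapting it to `θ i` strictly raises the total gain.
  have hinit : ∀ i j, i < j → b j ≠ 0 → b i ≠ 0 := by
    intro i j hij hj hi
    have hbj : 0 < b j := lt_of_le_of_ne (hb j) hj.symm
    have hlt : θ j < θ i := by
      refine lt_of_le_of_ne (hθ hij.le) fun h => ?_
      have := hlex i j hij.le h.symm
      linarith
    have hκj : κ < θ j := lt_of_gainArg_ne_zero (harg j hj ▸ hj)
    let c : Fin n → ℝ := Function.update (Function.update b j 0) i (gainArg κ l (θ i))
    have hc : ∀ k, 0 ≤ c k := by
      intro k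
      simp only [c, Function.update_apply]
      split_ifs
      exacts [gainArg_nonneg hκ hl, le_rfl, hb k]
    have hcc : {k | c k ≠ 0}.ncard ≤ d := by
      have hsub : {k | c k ≠ 0} ⊆ insert i ({k | b k ≠ 0} \ {j}) := by
        intro k hk
        by_cases hki : k = i
        · exact Or.inl hki
        · refine Or.inr ?_
          simp only [c, Function.update_apply, if_neg hki, Set.mem_ofPred_eq] at hk
          by_cases hkj : k = j
          · simp [hkj] at hk
          · rw [if_neg hkj] at hk
            exact ⟨hk, hkj⟩
      refine (Set.ncard_le_ncard hsub (Set.toFinite _)).trans ((Set.ncard_insert_le _ _).trans ?_)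
      rw [Set.ncard_sdiff_singleton_add_one hj (Set.toFinite _)]
      exact hcard
    have h1 := (H c hc hcc).1
    rw [← heq] at h1
    have h2 : ∑ k, (gain κ l (θ k) (c k) - gain κ l (θ k) (b k))
        = maxGain κ (θ i) - maxGain κ (θ j) := by
      rw [Finset.sum_eq_add_of_mem i j (Finset.mem_univ _) (Finset.mem_univ _) hij.ne]
      · simp only [c, Function.update_self, Function.update_of_ne hij.ne', hi, gain_zero hl,
          gain_gainArg hκ hl]
        rw [harg j hj, gain_gainArg hκ hl]
        ring
      · rintro k - ⟨hki, hkj⟩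
        simp [c, Function.update_of_ne hki, Function.update_of_ne hkj]
    rw [Finset.sum_sub_distrib] at h2
    linarith [maxGain_strictMono hκ hlt (hκj.trans hlt)]
  -- The support is an initial segment, so a nonzero `b i` brings `i + 1` nonzero values with it.
  have hlt : ∀ i : Fin n, b i ≠ 0 → (i : ℕ) < d := by
    intro i hi
    have hsub : ((Finset.Iic i : Finset (Fin n)) : Set (Fin n)) ⊆ {j | b j ≠ 0} := by
      intro j hj
      rcases (Finset.mem_Iic.1 hj).eq_or_lt with h | h
      · rw [h]
        exact hi
      · exact hinit j i h hi
    have := (Set.ncard_le_ncard hsub (Set.toFinite _)).trans hcard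
    rw [Set.ncard_coe_finset, Fin.card_Iic] at this
    exact this
  have hle : ∀ i ∈ Finset.univ, gain κ l (θ i) (b i)
      ≤ if (i : ℕ) < d then maxGain κ (θ i) else 0 := by
    intro i _
    split_ifs with h
    · exact gain_le hκ hl (hb i)
    · rw [not_not.1 fun hne => h (hlt i hne), gain_zero hl]
  have hterm := (Finset.sum_eq_sum_iff_of_le hle).1 heq
  funext i
  by_cases hid : (i : ℕ) < d
  · rw [if_pos hid]
    have := hterm i (Finset.mem_univ _)
    rw [if_pos hid] at this
    by_contra hne
    exact (gain_lt hκ hl (hb i) hne).ne this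
  · rw [if_neg hid]
    exact not_not.1 fun hne => hid (hlt i hne)

/-! ### Positive semidefinite factors and the optimal encoder variance -/

theorem IsOrthDiag.transpose_mul_mul {N : ℕ} {A P : Matrix (Fin N) (Fin N) ℝ} {a : Fin N → ℝ}
    (h : IsOrthDiag A P a) : Pᵀ * A * P = diagonal a := by
  rw [Matrix.mul_assoc, h.mul_eq, orth_transpose_mul_cancel h.1]

theorem IsOrthDiag.nonneg {N : ℕ} {A P : Matrix (Fin N) (Fin N) ℝ} {a : Fin N → ℝ}
    (h : IsOrthDiag A P a) (hA : A.PosSemidef) (i : Fin N) : 0 ≤ a i := by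
  have := hA.conjTranspose_mul_mul_same P
  rw [conjTranspose_eq_transpose_of_trivial, h.transpose_mul_mul] at this
  exact posSemidef_diagonal_iff.1 this i

theorem exists_mul_transpose_eq {N : ℕ} {A : Matrix (Fin N) (Fin N) ℝ} (hA : A.PosSemidef) :
    ∃ R : Matrix (Fin N) (Fin N) ℝ, R * Rᵀ = A := by
  obtain ⟨P, a, h⟩ := exists_isOrthDiag hA.1
  refine ⟨P * diagonal fun i => √(a i), ?_⟩
  rw [transpose_mul, diagonal_transpose, Matrix.mul_assoc, ← Matrix.mul_assoc (diagonal _),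
    diagonal_mul_diagonal, ← Matrix.mul_assoc]
  simp only [Real.mul_self_sqrt (h.nonneg hA _)]
  exact h.2.symm

theorem posSemidef_mul_transpose {m n : ℕ} (A : Matrix (Fin m) (Fin n) ℝ) :
    (A * Aᵀ).PosSemidef := by
  rw [← conjTranspose_eq_transpose_of_trivial]
  exact posSemidef_self_mul_conjTranspose A

/-- The regularized Gram matrix `Uᵀ U + l I`. -/
def regGram {m n : ℕ} (l : ℝ) (U : Matrix (Fin m) (Fin n) ℝ) : Matrix (Fin n) (Fin n) ℝ :=
  Uᵀ * U + l • 1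

theorem regGram_posDef {m n : ℕ} {l : ℝ} (hl : 0 < l) (U : Matrix (Fin m) (Fin n) ℝ) :
    (regGram l U).PosDef := by
  have h := posSemidef_mul_transpose Uᵀ
  rw [transpose_transpose] at h
  exact (PosDef.one.smul hl).posSemidef_add h

theorem isUnit_det_regGram {m n : ℕ} {l : ℝ} (hl : 0 < l) (U : Matrix (Fin m) (Fin n) ℝ) :
    IsUnit (regGram l U).det := (regGram_posDef hl U).det_pos.ne'.isUnit

/-- The optimal encoder variance for a given decoder. -/
theorem trace_sub_log_det_ge {n : ℕ} {A S : Matrix (Fin n) (Fin n) ℝ} {κ : ℝ} (hκ : 0 < κ)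
    (hA : A.PosDef) (hS : S.PosDef) :
    κ * n - κ * (n * Real.log κ) + κ * Real.log A.det ≤ (A * S).trace - κ * Real.log S.det ∧
      ((A * S).trace - κ * Real.log S.det = κ * n - κ * (n * Real.log κ) + κ * Real.log A.det →
        S = κ • A⁻¹) := by
  obtain ⟨R, hR⟩ := exists_mul_transpose_eq hA.posSemidef
  have hdR : IsUnit R.det := by
    have := hA.det_pos.ne'
    rw [← hR, det_mul] at this
    exact (left_ne_zero_of_mul this).isUnit
  -- With `A = R Rᵀ` this symmetric matrix has the trace and determinant of κ⁻¹AS, and equals the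
  -- identity exactly at the claimed optimum.
  have hX : (κ⁻¹ • (Rᵀ * S * R)).PosDef := by
    have := hS.conjTranspose_mul_mul_same (B := R)
      (mulVec_injective_of_isUnit ((isUnit_iff_isUnit_det _).2 hdR))
    rw [conjTranspose_eq_transpose_of_trivial] at this
    exact this.smul (inv_pos.2 hκ)
  have htr : (κ⁻¹ • (Rᵀ * S * R)).trace = κ⁻¹ * (A * S).trace := by
    rw [trace_smul, smul_eq_mul, Matrix.trace_mul_comm, ← Matrix.mul_assoc, hR]
  have hdet : Real.log (κ⁻¹ • (Rᵀ * S * R)).det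
      = -(n * Real.log κ) + Real.log A.det + Real.log S.det := by
    have h1 : (κ⁻¹ • (Rᵀ * S * R)).det = (κ⁻¹) ^ n * (A.det * S.det) := by
      rw [det_smul, Fintype.card_fin, det_mul, det_mul, ← hR, det_mul]
      ring
    rw [h1, Real.log_mul (by positivity) (mul_ne_zero hA.det_pos.ne' hS.det_pos.ne'),
      Real.log_mul hA.det_pos.ne' hS.det_pos.ne', Real.log_pow, Real.log_inv]
    ring
  obtain ⟨h1, h2⟩ := log_det_le_trace hX
  rw [htr, hdet] at h1 h2
  have h3 : κ * (κ⁻¹ * (A * S).trace - n) = (A * S).trace - κ * n := by field_simp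
  constructor
  · have := mul_le_mul_of_nonneg_left h1 hκ.le
    rw [h3] at this
    linarith
  · intro h
    have h4 : Rᵀ * S * R = κ • 1 := by
      rw [← h2 (mul_left_cancel₀ hκ.ne' (by rw [h3]; linarith)), smul_smul,
        mul_inv_cancel₀ hκ.ne', one_smul]
    have h5 : A * S = κ • 1 := by
      have h6 : A * S * R = κ • R := by
        rw [← hR, Matrix.mul_assoc R, Matrix.mul_assoc, h4, Matrix.mul_smul, Matrix.mul_one]
      rw [← Matrix.mul_nonsing_inv_cancel_right R (A * S) hdR, h6, Matrix.smul_mul,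
        mul_nonsing_inv R hdR]
    rw [← Matrix.nonsing_inv_mul_cancel_left A S hA.det_pos.ne'.isUnit, h5, Matrix.mul_smul,
      Matrix.mul_one]

theorem trace_sub_log_det_eq {n : ℕ} {A : Matrix (Fin n) (Fin n) ℝ} {κ : ℝ} (hκ : 0 < κ)
    (hA : A.PosDef) :
    (A * (κ • A⁻¹)).trace - κ * Real.log (κ • A⁻¹).det
      = κ * n - κ * (n * Real.log κ) + κ * Real.log A.det := by
  have hd := hA.det_pos
  rw [Matrix.mul_smul, mul_nonsing_inv A hd.ne'.isUnit, trace_smul, trace_one, Fintype.card_fin,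
    det_smul, Fintype.card_fin, det_nonsing_inv, Ring.inverse_eq_inv',
    Real.log_mul (by positivity) (inv_ne_zero hd.ne'), Real.log_pow, Real.log_inv, smul_eq_mul]
  ring

/-! ### Completing the squares in the loss -/

theorem frobSq_eq_trace' {m n : ℕ} (M : Matrix (Fin m) (Fin n) ℝ) :
    frobSq M = (M * Mᵀ).trace := by
  rw [frobSq_eq_trace, Matrix.trace_mul_comm]

/-- The quadratic form `E ‖X x̃ + Y ỹ‖²` for whitened `x̃, ỹ` with cross moment `Z`. -/
theorem frobSq_pair {m d0 d2 : ℕ} {Z : Matrix (Fin d0) (Fin d2) ℝ} {N : Matrix (Fin d2) (Fin d2) ℝ}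
    (hN : N * Nᵀ = 1 - Zᵀ * Z) (X : Matrix (Fin m) (Fin d0) ℝ) (Y : Matrix (Fin m) (Fin d2) ℝ) :
    frobSq X + frobSq Y + 2 * (Yᵀ * X * Z).trace = frobSq (X + Y * Zᵀ) + frobSq (Y * N) := by
  have h1 : (Y * N * (Y * N)ᵀ).trace = (Y * Yᵀ).trace - (Y * Zᵀ * (Y * Zᵀ)ᵀ).trace := by
    have : Y * N * (Y * N)ᵀ = Y * (N * Nᵀ) * Yᵀ := by
      simp only [transpose_mul, Matrix.mul_assoc]
    rw [this, hN, ← trace_sub]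
    congr 1
    simp only [transpose_mul, transpose_transpose, Matrix.mul_sub, Matrix.sub_mul,
      Matrix.mul_one, Matrix.mul_assoc]
  have h2 : (Yᵀ * X * Z).trace = (X * (Y * Zᵀ)ᵀ).trace := by
    rw [transpose_mul, transpose_transpose, Matrix.mul_assoc, Matrix.trace_mul_comm,
      Matrix.mul_assoc]
  have h3 : (Y * Zᵀ * Xᵀ).trace = (X * (Y * Zᵀ)ᵀ).trace := by
    rw [← trace_transpose, transpose_mul, transpose_transpose]
  simp only [frobSq_eq_trace']
  rw [h1, h2, transpose_add, Matrix.add_mul, Matrix.mul_add, Matrix.mul_add, trace_add, trace_add,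
    trace_add, h3]
  ring

theorem frobSq_add {m n : ℕ} (P Q : Matrix (Fin m) (Fin n) ℝ) :
    frobSq (P + Q) = frobSq P + frobSq Q + 2 * (Pᵀ * Q).trace := by
  have : (Qᵀ * P).trace = (Pᵀ * Q).trace := by
    rw [← trace_transpose, transpose_mul, transpose_transpose]
  simp only [frobSq_eq_trace]
  rw [transpose_add, Matrix.add_mul, Matrix.mul_add, Matrix.mul_add, trace_add, trace_add,
    trace_add, this]
  ring

/-- The ridge regression identity. -/
theorem frobSq_ridge {m n p : ℕ} {l : ℝ} (hl : 0 < l) (U : Matrix (Fin m) (Fin n) ℝ)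
    (G : Matrix (Fin m) (Fin p) ℝ) (W : Matrix (Fin n) (Fin p) ℝ) :
    frobSq (U * W - G) + l * frobSq W
      = frobSq (U * (W - (regGram l U)⁻¹ * Uᵀ * G)) + l * frobSq (W - (regGram l U)⁻¹ * Uᵀ * G)
        + (G * Gᵀ * (1 - U * (regGram l U)⁻¹ * Uᵀ)).trace := by
  set V := (regGram l U)⁻¹ * Uᵀ * G with hV
  -- The normal equations of the ridge problem; they make the cross terms cancel below.
  have hA : Uᵀ * (U * V) + l • V = Uᵀ * G := by
    have : regGram l U * V = Uᵀ * G := by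
      rw [hV, Matrix.mul_assoc, Matrix.mul_nonsing_inv_cancel_left _ _ (isUnit_det_regGram hl U)]
    rwa [regGram, Matrix.add_mul, Matrix.smul_mul, Matrix.one_mul, Matrix.mul_assoc] at this
  have e1 : U * W - G = U * (W - V) + (U * V - G) := by rw [Matrix.mul_sub]; abel
  have e2 : frobSq W = frobSq (W - V) + frobSq V + 2 * ((W - V)ᵀ * V).trace := by
    rw [← frobSq_add, sub_add_cancel]
  have cross : ((U * (W - V))ᵀ * (U * V - G)).trace + l * ((W - V)ᵀ * V).trace = 0 := by
    rw [transpose_mul, Matrix.mul_assoc, Matrix.mul_sub, ← smul_eq_mul, ← trace_smul,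
      ← Matrix.mul_smul, ← trace_add, ← Matrix.mul_add, sub_add_eq_add_sub, hA, sub_self,
      Matrix.mul_zero, trace_zero]
  have e3 : frobSq (U * V - G) + l * frobSq V
      = (G * Gᵀ * (1 - U * (regGram l U)⁻¹ * Uᵀ)).trace := by
    have h1 : frobSq (U * V - G) = frobSq (U * V) + frobSq G - 2 * (Gᵀ * (U * V)).trace := by
      have := frobSq_add (-G) (U * V)
      rw [neg_add_eq_sub] at this
      rw [this, transpose_neg, Matrix.neg_mul, trace_neg, frobSq_eq_trace (-G), transpose_neg,
        Matrix.neg_mul, Matrix.mul_neg, neg_neg, ← frobSq_eq_trace]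
      ring
    have h2 : frobSq (U * V) + l * frobSq V = (Gᵀ * (U * V)).trace := by
      rw [frobSq_eq_trace, frobSq_eq_trace, transpose_mul, Matrix.mul_assoc, ← smul_eq_mul,
        ← trace_smul, ← Matrix.mul_smul, ← trace_add, ← Matrix.mul_add, hA, ← trace_transpose]
      simp only [transpose_mul, transpose_transpose, Matrix.mul_assoc]
    have h3 : (G * Gᵀ * (U * (regGram l U)⁻¹ * Uᵀ)).trace = (Gᵀ * (U * V)).trace := by
      rw [Matrix.mul_assoc, Matrix.trace_mul_comm, hV]
      simp only [Matrix.mul_assoc]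
    rw [Matrix.mul_sub, Matrix.mul_one, trace_sub, h3, ← frobSq_eq_trace' G, ← h2, h1]
    linarith
  rw [e1, frobSq_add, e2]
  linarith

/-- The objective minimized over everything but the decoder matrix `U`, up to a constant. -/
def reduced {m n : ℕ} (κ l : ℝ) (E : Matrix (Fin m) (Fin m) ℝ) (U : Matrix (Fin m) (Fin n) ℝ) : ℝ :=
  (E * (1 - U * (regGram l U)⁻¹ * Uᵀ)).trace + κ * Real.log (regGram l U).det

/-- `frobSq_pair` is applied to the decoder and to the encoder form, then `frobSq_ridge` to the part
seen through `N`. Given `U1`, all squares on the right can vanish simultaneously, and `Sig` is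
decoupled from the other variables. -/
theorem loss_eq {D2 d0 d1 d2 : ℕ} {β ηenc ηdec : ℝ} (hβ : 0 < β) (hηenc : 0 < ηenc)
    (hηdec : 0 < ηdec) {D : Matrix (Fin D2) (Fin d2) ℝ} {Z : Matrix (Fin d0) (Fin d2) ℝ}
    {N : Matrix (Fin d2) (Fin d2) ℝ} (hN : N * Nᵀ = 1 - Zᵀ * Z)
    (U1 : Matrix (Fin D2) (Fin d1) ℝ) (V1 : Matrix (Fin d1) (Fin d0) ℝ)
    (V2 : Matrix (Fin d1) (Fin d2) ℝ) (T2 : Matrix (Fin D2) (Fin d0) ℝ)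
    (Sig : Matrix (Fin d1) (Fin d1) ℝ) {l : ℝ} (hl : l = β * (ηdec / ηenc) ^ 2) :
    ηdec ^ 2 * loss β ηenc ηdec D Z U1 V1 V2 T2 Sig
      = frobSq (U1 * (V1 + V2 * Zᵀ) + (T2 - D * Zᵀ)) + l * frobSq (V1 + V2 * Zᵀ)
        + (frobSq (U1 * (V2 * N - (regGram l U1)⁻¹ * U1ᵀ * (D * N)))
          + l * frobSq (V2 * N - (regGram l U1)⁻¹ * U1ᵀ * (D * N)))
        + (regGram l U1 * Sig).trace - β * ηdec ^ 2 * Real.log Sig.det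
        + (D * (1 - Zᵀ * Z) * Dᵀ * (1 - U1 * (regGram l U1)⁻¹ * U1ᵀ)).trace := by
  have hl0 : 0 < l := by rw [hl]; positivity
  have h1 := frobSq_pair hN (U1 * V1 + T2) (U1 * V2 - D)
  have h2 := frobSq_pair hN V1 V2
  have h3 := frobSq_ridge hl0 U1 (D * N) (V2 * N)
  have e1 : U1 * V1 + T2 + (U1 * V2 - D) * Zᵀ = U1 * (V1 + V2 * Zᵀ) + (T2 - D * Zᵀ) := by
    rw [Matrix.sub_mul, Matrix.mul_add, Matrix.mul_assoc]
    abel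
  have e2 : (U1 * V2 - D) * N = U1 * (V2 * N) - D * N := by
    rw [Matrix.sub_mul, Matrix.mul_assoc]
  have e3 : D * N * (D * N)ᵀ = D * (1 - Zᵀ * Z) * Dᵀ := by
    rw [← hN]
    simp only [transpose_mul, Matrix.mul_assoc]
  have e4 : (V2ᵀ * V1 * Z).trace = (V1 * Z * V2ᵀ).trace := by
    rw [Matrix.mul_assoc, Matrix.trace_mul_comm]
  rw [e1, e2] at h1
  rw [e3] at h3
  rw [e4] at h2
  have h0 : ηdec ^ 2 * loss β ηenc ηdec D Z U1 V1 V2 T2 Sig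
      = (frobSq (U1 * V1 + T2) + frobSq (U1 * V2 - D)
          + 2 * ((U1 * V2 - D)ᵀ * (U1 * V1 + T2) * Z).trace)
        + (regGram l U1 * Sig).trace
        + l * (frobSq V1 + frobSq V2 + 2 * (V1 * Z * V2ᵀ).trace)
        - β * ηdec ^ 2 * Real.log Sig.det := by
    rw [loss, ← hl, regGram]
    field_simp
  rw [h0, h1, h2]
  linarith

/-! ### Spectral form of the reduced objective -/

theorem trace_mul_of_isOrthDiag {n : ℕ} {E P H S : Matrix (Fin n) (Fin n) ℝ} {a h : Fin n → ℝ}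
    (hE : IsOrthDiag E P a) (hH : IsOrthDiag H S h) :
    (E * H).trace = ∑ i, ∑ j, (Pᵀ * S) i j ^ 2 * (a i * h j) := by
  have : (E * H).trace = (diagonal a * (Pᵀ * S) * diagonal h * (Pᵀ * S)ᵀ).trace := by
    rw [hE.2, hH.2, Matrix.mul_assoc, Matrix.mul_assoc, Matrix.trace_mul_comm]
    simp only [transpose_mul, transpose_transpose, Matrix.mul_assoc]
  rw [this, trace]
  refine Finset.sum_congr rfl fun i _ => ?_
  rw [diag_apply, mul_apply]
  refine Finset.sum_congr rfl fun j _ => ?_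
  rw [mul_diagonal, diagonal_mul, transpose_apply]
  ring

theorem orth_row_sum {n : ℕ} {W : Matrix (Fin n) (Fin n) ℝ} (hW : W * Wᵀ = 1) (i : Fin n) :
    ∑ j, W i j ^ 2 = 1 := by
  have := congrFun (congrFun hW i) i
  rw [mul_apply, one_apply_eq] at this
  simpa only [transpose_apply, ← sq] using this

theorem orth_transpose_mul_mem {n : ℕ} {P S : Matrix (Fin n) (Fin n) ℝ}
    (hP : P ∈ Matrix.orthogonalGroup (Fin n) ℝ) (hS : S ∈ Matrix.orthogonalGroup (Fin n) ℝ) :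
    Pᵀ * S ∈ Matrix.orthogonalGroup (Fin n) ℝ :=
  mul_mem (orth_transpose_mem hP) hS

/-- The push-through identity (UUᵀ + l)U = U(UᵀU + l) shows that the matrix is l(UUᵀ + l)⁻¹. -/
theorem isOrthDiag_resolvent {m n : ℕ} {l : ℝ} (hl : 0 < l) {U : Matrix (Fin m) (Fin n) ℝ}
    {S : Matrix (Fin m) (Fin m) ℝ} {b : Fin m → ℝ} (hB : IsOrthDiag (U * Uᵀ) S b)
    (hb : ∀ j, 0 ≤ b j) :
    IsOrthDiag (1 - U * (regGram l U)⁻¹ * Uᵀ) S fun j => l / (b j + l) := by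
  set H := 1 - U * (regGram l U)⁻¹ * Uᵀ with hH
  have h1 : (U * Uᵀ + l • 1) * H = l • 1 := by
    have h2 : (U * Uᵀ + l • 1) * U = U * regGram l U := by
      rw [regGram, Matrix.add_mul, Matrix.mul_add, Matrix.smul_mul, Matrix.mul_smul,
        Matrix.one_mul, Matrix.mul_one, Matrix.mul_assoc]
    rw [hH, Matrix.mul_sub, Matrix.mul_one, Matrix.mul_assoc U, ← Matrix.mul_assoc _ U, h2,
      Matrix.mul_assoc U, Matrix.mul_nonsing_inv_cancel_left _ _ (isUnit_det_regGram hl U)]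
    abel
  have h3 : (U * Uᵀ + l • 1) * S = S * diagonal fun j => b j + l := by
    rw [Matrix.add_mul, hB.mul_eq, Matrix.smul_mul, Matrix.one_mul]
    ext i j
    simp only [Matrix.add_apply, mul_diagonal, Matrix.smul_apply, smul_eq_mul]
    ring
  have hu : IsUnit (U * Uᵀ + l • (1 : Matrix (Fin m) (Fin m) ℝ)) :=
    ((PosDef.one.smul hl).posSemidef_add (posSemidef_mul_transpose U)).isUnit
  refine isOrthDiag_of_mul_eq hB.1 (hu.mul_left_cancel ?_)
  rw [← Matrix.mul_assoc, h1, ← Matrix.mul_assoc, h3, Matrix.mul_assoc, diagonal_mul_diagonal]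
  ext i j
  have : b j + l ≠ 0 := by linarith [hb j]
  simp only [smul_mul, Matrix.one_mul, Matrix.smul_apply, smul_eq_mul, mul_diagonal]
  field_simp

/-- Sylvester's determinant identity passes from UᵀU to UUᵀ. Factoring out `l` first absorbs the
difference in size into the term `n * Real.log l`. -/
theorem log_det_regGram {m n : ℕ} {l : ℝ} (hl : 0 < l) {U : Matrix (Fin m) (Fin n) ℝ}
    {S : Matrix (Fin m) (Fin m) ℝ} {b : Fin m → ℝ} (hB : IsOrthDiag (U * Uᵀ) S b)
    (hb : ∀ j, 0 ≤ b j) :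
    Real.log (regGram l U).det = n * Real.log l + ∑ j, Real.log ((b j + l) / l) := by
  have h1 : regGram l U = l • (1 + (l⁻¹ • Uᵀ) * U) := by
    rw [regGram, smul_add, Matrix.smul_mul, smul_smul, mul_inv_cancel₀ hl.ne', one_smul, add_comm]
  have h2 : IsOrthDiag (1 + U * (l⁻¹ • Uᵀ)) S fun j => (b j + l) / l := by
    refine isOrthDiag_of_mul_eq hB.1 ?_
    rw [Matrix.mul_smul, Matrix.add_mul, Matrix.smul_mul, hB.mul_eq, Matrix.one_mul]
    ext i j
    simp only [Matrix.add_apply, mul_diagonal, Matrix.smul_apply, smul_eq_mul]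
    field_simp
    ring
  have h3 : ∀ j, 0 < (b j + l) / l := fun j => div_pos (by linarith [hb j]) hl
  rw [h1, det_smul, det_one_add_mul_comm, h2.det, Fintype.card_fin,
    Real.log_mul (by positivity) (Finset.prod_pos fun j _ => h3 j).ne', Real.log_pow,
    Real.log_prod fun j _ => (h3 j).ne']

/-- Since the squared overlaps have row and column sums 1, the single sums over `θ` and over the
logarithms can join the trace in one double sum. -/
theorem reduced_eq {m n : ℕ} {κ l : ℝ} (hl : 0 < l) {E P S : Matrix (Fin m) (Fin m) ℝ}
    {θ b : Fin m → ℝ} {U : Matrix (Fin m) (Fin n) ℝ} (hE : IsOrthDiag E P θ)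
    (hB : IsOrthDiag (U * Uᵀ) S b) (hb : ∀ j, 0 ≤ b j) :
    reduced κ l E U = (∑ i, θ i + κ * (n * Real.log l))
      - ∑ i, ∑ j, (Pᵀ * S) i j ^ 2 * gain κ l (θ i) (b j) := by
  have hW := orth_transpose_mul_mem hE.1 hB.1
  have hrow := fun i => orth_row_sum (orth_mul_transpose hW) i
  have hcol := fun j => orth_row_sum (W := (Pᵀ * S)ᵀ)
    (by rw [transpose_transpose]; exact orth_transpose_mul hW) j
  simp only [transpose_apply] at hcol
  rw [reduced, trace_mul_of_isOrthDiag hE (isOrthDiag_resolvent hl hB hb), log_det_regGram hl hB hb]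
  have h1 : ∑ i, θ i = ∑ i, ∑ j, (Pᵀ * S) i j ^ 2 * θ i :=
    Finset.sum_congr rfl fun i _ => by rw [← Finset.sum_mul, hrow, one_mul]
  have h2 : ∑ j, Real.log ((b j + l) / l)
      = ∑ i, ∑ j, (Pᵀ * S) i j ^ 2 * Real.log ((b j + l) / l) := by
    rw [Finset.sum_comm]
    exact Finset.sum_congr rfl fun j _ => by rw [← Finset.sum_mul, hcol, one_mul]
  rw [h1, h2]
  simp only [mul_add, Finset.mul_sum]
  have h3 : ∀ i j, (Pᵀ * S) i j ^ 2 * gain κ l (θ i) (b j) = (Pᵀ * S) i j ^ 2 * θ i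
      - (Pᵀ * S) i j ^ 2 * (θ i * (l / (b j + l)))
      - κ * ((Pᵀ * S) i j ^ 2 * Real.log ((b j + l) / l)) := by
    intro i j
    rw [gain]
    ring
  simp only [h3, Finset.sum_sub_distrib]
  ring

/-! ### Second moments of the whitened vectors -/

section Moments

variable {S : Type*} [MeasurableSpace S] {μ : Measure S}

theorem memLp_mulVec {m n : ℕ} {u : S → Fin n → ℝ} (hu : ∀ j, MemLp (fun s => u s j) 2 μ)
    (A : Matrix (Fin m) (Fin n) ℝ) (i : Fin m) : MemLp (fun s => (A *ᵥ u s) i) 2 μ := by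
  simp only [mulVec, dotProduct]
  exact memLp_finsetSum _ fun j _ => (hu j).const_mul (A i j)

theorem crossMoment_mulVec {m n p q : ℕ} {u : S → Fin n → ℝ} {v : S → Fin q → ℝ}
    (hu : ∀ j, MemLp (fun s => u s j) 2 μ) (hv : ∀ j, MemLp (fun s => v s j) 2 μ)
    (A : Matrix (Fin m) (Fin n) ℝ) (B : Matrix (Fin p) (Fin q) ℝ) :
    crossMoment μ (fun s => A *ᵥ u s) (fun s => B *ᵥ v s) = A * crossMoment μ u v * Bᵀ := by
  ext i j
  have hint : ∀ k l, Integrable (fun s => A i k * u s k * (B j l * v s l)) μ := fun k l =>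
    MemLp.integrable_mul ((hu k).const_mul (A i k)) ((hv l).const_mul (B j l))
  simp only [crossMoment, of_apply, mulVec, dotProduct, mul_apply, transpose_apply]
  simp only [Finset.sum_mul_sum]
  rw [integral_finsetSum _ fun k _ => integrable_finsetSum _ fun l _ => hint k l]
  rw [Finset.sum_congr rfl fun k _ => integral_finsetSum _ fun l _ => hint k l]
  simp only [Finset.sum_mul]
  rw [Finset.sum_comm]
  refine Finset.sum_congr rfl fun l _ => Finset.sum_congr rfl fun k _ => ?_
  rw [mul_right_comm, ← integral_const_mul]
  exact integral_congr_ae (Filter.Eventually.of_forall fun s => by ring)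

theorem crossMoment_transpose {m n : ℕ} (u : S → Fin m → ℝ) (v : S → Fin n → ℝ) :
    (crossMoment μ u v)ᵀ = crossMoment μ v u := by
  ext i j
  simp [crossMoment, mul_comm]

theorem crossMoment_sub {m : ℕ} {u v : S → Fin m → ℝ}
    (hu : ∀ j, MemLp (fun s => u s j) 2 μ) (hv : ∀ j, MemLp (fun s => v s j) 2 μ) :
    crossMoment μ (fun s => u s - v s) (fun s => u s - v s)
      = crossMoment μ u u - crossMoment μ u v - crossMoment μ v u + crossMoment μ v v := by
  ext i j
  have h1 : Integrable (fun s => u s i * u s j) μ := MemLp.integrable_mul (hu i) (hu j)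
  have h2 : Integrable (fun s => u s i * v s j) μ := MemLp.integrable_mul (hu i) (hv j)
  have h3 : Integrable (fun s => v s i * u s j) μ := MemLp.integrable_mul (hv i) (hu j)
  have h4 : Integrable (fun s => v s i * v s j) μ := MemLp.integrable_mul (hv i) (hv j)
  simp only [crossMoment, of_apply, Matrix.sub_apply, Matrix.add_apply, Pi.sub_apply]
  have h5 : Integrable (fun s => u s i * u s j - u s i * v s j) μ := h1.sub h2
  have h6 : Integrable (fun s => u s i * u s j - u s i * v s j - v s i * u s j) μ := h5.sub h3
  rw [← integral_sub h1 h2, ← integral_sub h5 h3, ← integral_add h6 h4]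
  exact integral_congr_ae (Filter.Eventually.of_forall fun s => by ring)

theorem crossMoment_self_posSemidef {m : ℕ} {u : S → Fin m → ℝ}
    (hu : ∀ j, MemLp (fun s => u s j) 2 μ) : (crossMoment μ u u).PosSemidef := by
  refine PosSemidef.of_dotProduct_mulVec_nonneg ?_ fun a => ?_
  · rw [IsHermitian, conjTranspose_eq_transpose_of_trivial, crossMoment_transpose]
  -- Regarding `a` as a one-row matrix turns the quadratic form into the mean of the square of a·u.
  · have h := crossMoment_mulVec hu hu (Matrix.of fun (_ : Fin 1) j => a j)
      (Matrix.of fun (_ : Fin 1) j => a j)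
    have h1 := congrFun (congrFun h 0) 0
    have h2 : star a ⬝ᵥ crossMoment μ u u *ᵥ a
        = ((Matrix.of fun (_ : Fin 1) j => a j) * crossMoment μ u u *
          (Matrix.of fun (_ : Fin 1) j => a j)ᵀ) 0 0 := by
      rw [Matrix.mul_assoc]
      simp [mul_apply, dotProduct, mulVec]
    rw [h2, ← h1]
    exact integral_nonneg fun s => mul_self_nonneg _

theorem whiten_memLp {N d : ℕ} {x : S → Fin N → ℝ} (hx : MemLp x 2 μ)
    (P : Matrix (Fin N) (Fin d) ℝ) (φ : Fin d → ℝ) (i : Fin d) :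
    MemLp (fun s => whiten P φ x s i) 2 μ :=
  memLp_mulVec (fun j => hx.eval j) _ i

theorem crossMoment_whiten_self {N d : ℕ} {x : S → Fin N → ℝ} (hx : MemLp x 2 μ)
    {P : Matrix (Fin N) (Fin d) ℝ} {φ : Fin d → ℝ}
    (h : IsReducedEigenDecomp (crossMoment μ x x) P φ) :
    crossMoment μ (whiten P φ x) (whiten P φ x) = 1 := by
  have hcomp := fun j => hx.eval (p := 2) j
  rw [show whiten P φ x = fun s => (Matrix.diagonal (fun i => (√(φ i))⁻¹) * Pᵀ) *ᵥ x s from rfl,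
    crossMoment_mulVec hcomp hcomp, h.2.2]
  have : diagonal (fun i => (√(φ i))⁻¹) * Pᵀ * (P * diagonal φ * Pᵀ)
      * (diagonal (fun i => (√(φ i))⁻¹) * Pᵀ)ᵀ
      = diagonal (fun i => (√(φ i))⁻¹) * (Pᵀ * P) * diagonal φ * (Pᵀ * P)
        * diagonal (fun i => (√(φ i))⁻¹) := by
    simp only [transpose_mul, transpose_transpose, diagonal_transpose, Matrix.mul_assoc]
  rw [this, h.1, Matrix.mul_one, Matrix.mul_one, diagonal_mul_diagonal, diagonal_mul_diagonal,
    ← diagonal_one]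
  congr 1
  funext i
  have h1 := Real.sqrt_pos.2 (h.2.1 i)
  nth_rewrite 2 [← Real.mul_self_sqrt (h.2.1 i).le]
  field_simp

/-- The residual covariance of the whitened `y` after regression on the whitened `x`. -/
theorem one_sub_posSemidef {D0 D2 d0 d2 : ℕ} {x : S → Fin D0 → ℝ} {y : S → Fin D2 → ℝ}
    (hx : MemLp x 2 μ) (hy : MemLp y 2 μ)
    {PA : Matrix (Fin D0) (Fin d0) ℝ} {φ : Fin d0 → ℝ}
    {PB : Matrix (Fin D2) (Fin d2) ℝ} {ψ : Fin d2 → ℝ}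
    (hA : IsReducedEigenDecomp (crossMoment μ x x) PA φ)
    (hB : IsReducedEigenDecomp (crossMoment μ y y) PB ψ)
    {Z : Matrix (Fin d0) (Fin d2) ℝ}
    (hZ : Z = crossMoment μ (whiten PA φ x) (whiten PB ψ y)) : (1 - Zᵀ * Z).PosSemidef := by
  have mx := whiten_memLp hx PA φ
  have my := whiten_memLp hy PB ψ
  have mz := memLp_mulVec mx Zᵀ
  have h := crossMoment_self_posSemidef (u := fun s => whiten PB ψ y s - Zᵀ *ᵥ whiten PA φ x s)
    fun j => (my j).sub (mz j)
  rw [crossMoment_sub my mz] at h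
  have h1 := crossMoment_mulVec mx my Zᵀ (1 : Matrix (Fin d2) (Fin d2) ℝ)
  simp only [one_mulVec, transpose_one, Matrix.mul_one] at h1
  have h2 := crossMoment_mulVec mx mx Zᵀ Zᵀ
  rw [crossMoment_whiten_self hx hA, Matrix.mul_one, transpose_transpose] at h2
  rw [← hZ] at h1
  rw [← crossMoment_transpose (fun s => Zᵀ *ᵥ whiten PA φ x s) (fun s => whiten PB ψ y s)] at h
  rw [h2, crossMoment_whiten_self hy hB] at h
  have h3 : crossMoment μ (fun s => Zᵀ *ᵥ whiten PA φ x s) (fun s => whiten PB ψ y s) = Zᵀ * Z := h1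
  rw [h3, transpose_mul, transpose_transpose] at h
  convert h using 1
  abel

end Moments

/-! ### Minimizers of the reduced objective -/

theorem ncard_eigenvalues_ne_zero_le {m n : ℕ} {U : Matrix (Fin m) (Fin n) ℝ}
    {S : Matrix (Fin m) (Fin m) ℝ} {b : Fin m → ℝ} (hB : IsOrthDiag (U * Uᵀ) S b) :
    {j | b j ≠ 0}.ncard ≤ n := by
  rw [← hB.rank]
  exact (Matrix.rank_mul_le_left _ _).trans (Matrix.rank_le_width U)

/-- The constant part of the reduced objective. -/
def reducedConst {m : ℕ} (n : ℕ) (κ l : ℝ) (θ : Fin m → ℝ) : ℝ :=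
  ∑ i, θ i + κ * (n * Real.log l)

theorem reduced_ge {m n : ℕ} {κ l : ℝ} (hκ : 0 < κ) (hl : 0 < l) {E P : Matrix (Fin m) (Fin m) ℝ}
    {θ : Fin m → ℝ} (hE : IsOrderedEigenDecomp E P θ) (U : Matrix (Fin m) (Fin n) ℝ) :
    reducedConst n κ l θ - totalGain n κ θ ≤ reduced κ l E U := by
  obtain ⟨S, b, hB⟩ := exists_isOrthDiag (posSemidef_mul_transpose U).1
  have hb := hB.nonneg (posSemidef_mul_transpose U)
  have hW := orth_transpose_mul_mem hE.1 hB.1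
  have := (sum_gain_le (w := fun i j => (Pᵀ * S) i j ^ 2) hκ hl hE.2.1 hb
    (ncard_eigenvalues_ne_zero_le hB) (fun _ _ => sq_nonneg _)
    (orth_row_sum (orth_mul_transpose hW))
    (orth_row_sum (W := (Pᵀ * S)ᵀ) (by rw [transpose_transpose]; exact orth_transpose_mul hW))).1
  rw [reduced_eq hl hE.isOrthDiag hB hb]
  exact sub_le_sub_left this _

theorem reduced_eq_of_isOrthDiag {m n : ℕ} {κ l : ℝ} (hl : 0 < l)
    {E P : Matrix (Fin m) (Fin m) ℝ} {θ b : Fin m → ℝ} {U : Matrix (Fin m) (Fin n) ℝ}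
    (hE : IsOrthDiag E P θ) (hB : IsOrthDiag (U * Uᵀ) P b) :
    reduced κ l E U = reducedConst n κ l θ - ∑ i, gain κ l (θ i) (b i) := by
  rw [reduced_eq hl hE hB (hB.nonneg (posSemidef_mul_transpose U)), orth_transpose_mul hE.1]
  simp [one_apply, reducedConst]

/-- Optimality gives θ_i = κ + (κ/l) b_j whenever b_j ≠ 0 and the eigenvectors overlap. Hence E·UUᵀ
is diagonal in the eigenbasis of UUᵀ, so it is symmetric, and a symmetric product of symmetric
matrices means that they commute. -/
theorem commute_of_reduced_eq {m n : ℕ} {κ l : ℝ} (hκ : 0 < κ) (hl : 0 < l)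
    {E P : Matrix (Fin m) (Fin m) ℝ} {θ : Fin m → ℝ} (hE : IsOrderedEigenDecomp E P θ)
    (U : Matrix (Fin m) (Fin n) ℝ)
    (h : reduced κ l E U = reducedConst n κ l θ - totalGain n κ θ) :
    E * (U * Uᵀ) = U * Uᵀ * E := by
  obtain ⟨S, b, hB⟩ := exists_isOrthDiag (posSemidef_mul_transpose U).1
  have hb := hB.nonneg (posSemidef_mul_transpose U)
  have hW := orth_transpose_mul_mem hE.1 hB.1
  have heq := (sum_gain_le (w := fun i j => (Pᵀ * S) i j ^ 2) hκ hl hE.2.1 hb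
    (ncard_eigenvalues_ne_zero_le hB) (fun _ _ => sq_nonneg _)
    (orth_row_sum (orth_mul_transpose hW))
    (orth_row_sum (W := (Pᵀ * S)ᵀ) (by rw [transpose_transpose]; exact orth_transpose_mul hW))).2
  rw [reduced_eq hl hE.isOrthDiag hB hb, reducedConst, sub_right_inj] at h
  have hloc := heq h
  have hdiag : diagonal θ * (Pᵀ * S) * diagonal b
      = Pᵀ * S * diagonal fun j => (κ + κ / l * b j) * b j := by
    ext i j
    rw [mul_diagonal, diagonal_mul, mul_diagonal]
    by_cases hbj : b j = 0
    · simp [hbj]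
    by_cases hw : (Pᵀ * S) i j = 0
    · simp [hw]
    have hbg := hloc i j hbj (pow_ne_zero 2 hw)
    have hθ : θ i = κ + κ / l * b j := by
      rw [hbg]
      exact eq_of_lt hκ hl (lt_of_gainArg_ne_zero (hbg ▸ hbj))
    rw [← hθ]
    ring
  have hEB : E * (U * Uᵀ) = S * (diagonal fun j => (κ + κ / l * b j) * b j) * Sᵀ := by
    have h1 : E * (U * Uᵀ) = P * (diagonal θ * (Pᵀ * S) * diagonal b) * Sᵀ := by
      rw [hE.2.2, hB.2]
      simp only [Matrix.mul_assoc]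
    rw [h1, hdiag]
    simp only [Matrix.mul_assoc]
    rw [orth_mul_cancel hE.1]
  have hEt : Eᵀ = E := by
    rw [hE.2.2]
    simp only [transpose_mul, transpose_transpose, diagonal_transpose, Matrix.mul_assoc]
  have hBt : (U * Uᵀ)ᵀ = U * Uᵀ := by rw [transpose_mul, transpose_transpose]
  have h2 : (E * (U * Uᵀ))ᵀ = E * (U * Uᵀ) := by
    rw [hEB]
    simp only [transpose_mul, transpose_transpose, diagonal_transpose, Matrix.mul_assoc]
  rw [transpose_mul, hEt, hBt] at h2
  exact h2.symm

theorem exists_orderedEigenDecomp_of_reduced_eq {m n : ℕ} {κ l : ℝ} (hκ : 0 < κ) (hl : 0 < l)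
    {E P : Matrix (Fin m) (Fin m) ℝ} {θ : Fin m → ℝ} (hE : IsOrderedEigenDecomp E P θ)
    (U : Matrix (Fin m) (Fin n) ℝ)
    (h : reduced κ l E U = reducedConst n κ l θ - totalGain n κ θ) :
    ∃ Q, IsOrderedEigenDecomp E Q θ ∧
      IsOrthDiag (U * Uᵀ) Q fun i => if (i : ℕ) < n then gainArg κ l (θ i) else 0 := by
  have hEh : E.IsHermitian := by
    rw [IsHermitian, conjTranspose_eq_transpose_of_trivial, hE.2.2]
    simp only [transpose_mul, transpose_transpose, diagonal_transpose, Matrix.mul_assoc]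
  obtain ⟨Q, e, b, hQe, hQb⟩ := exists_isOrthDiag_of_commute hEh (posSemidef_mul_transpose U).1
    (commute_of_reduced_eq hκ hl hE U h)
  -- The second key matters for repeated eigenvalues of `E`: within such a block the nonzero `b`
  -- must come first, as the block may straddle index `n`.
  obtain ⟨π, hπ⟩ := exists_perm_antitone fun i => toLex (e i, b i)
  have hlex : ∀ i j, i ≤ j → e (π j) < e (π i) ∨ e (π j) = e (π i) ∧ b (π j) ≤ b (π i) :=
    fun i j hij => Prod.Lex.toLex_le_toLex.1 (hπ hij)
  have hanti : Antitone (e ∘ π) := fun i j hij => (hlex i j hij).elim le_of_lt fun h => h.1.le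
  have heθ := hE.eq_of_isOrthDiag (hQe.perm π) hanti
  have hE' := hQe.perm π
  have hB' := hQb.perm π
  rw [heθ] at hE'
  refine ⟨_, ⟨hE'.1, hE.2.1, hE'.2⟩, ?_⟩
  have hgain := reduced_eq_of_isOrthDiag (κ := κ) hl hE' hB'
  rw [h, sub_right_inj] at hgain
  rw [← eq_of_sum_gain_eq hκ hl hE.2.1 (hB'.nonneg (posSemidef_mul_transpose U))
    (ncard_eigenvalues_ne_zero_le hB') _ hgain.symm]
  · exact hB'
  · intro i j hij hθ
    rw [← heθ] at hθ
    rcases hlex i j hij with h1 | h1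
    · exact absurd hθ h1.ne'
    · exact h1.2

/-! ### The optimal singular values -/

section Parameters

variable {β ηenc ηdec : ℝ}

theorem omega_sq (hβ : 0 < β) (hηenc : 0 < ηenc) (hηdec : 0 < ηdec) (t : ℝ) :
    omega β ηenc ηdec t ^ 2 = gainArg (β * ηdec ^ 2) (β * (ηdec / ηenc) ^ 2) t := by
  rw [omega, mul_pow, Real.sq_sqrt (le_max_left _ _), gainArg]
  field_simp

theorem omega_eq_zero (hβ : 0 < β) : omega β ηenc ηdec 0 = 0 := by
  have : (0 : ℝ) - β * ηdec ^ 2 ≤ 0 := by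
    have : 0 ≤ β * ηdec ^ 2 := by positivity
    linarith
  rw [omega, max_eq_left this, Real.sqrt_zero, mul_zero]

theorem extend_val {N : ℕ} (θ : Fin N → ℝ) (i : Fin N) : extend θ i = θ i := by
  simp [extend]

/-- Indexing the entries by rows gives the shape required by `exists_orth_of_mul_transpose`. -/
theorem Omega_eq {D2 : ℕ} (d1 : ℕ) (θ : Fin D2 → ℝ) :
    Omega d1 β ηenc ηdec θ = Matrix.of fun (i : Fin D2) (j : Fin d1) =>
      if (i : ℕ) = j then (if (i : ℕ) < d1 then omega β ηenc ηdec (θ i) else 0) else 0 := by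
  ext i j
  simp only [Omega, of_apply]
  split_ifs with h h'
  · rw [← h, extend_val]
  · exact absurd (h ▸ j.2) h'
  · rfl

theorem Omega_mul_transpose {D2 : ℕ} (d1 : ℕ) (θ : Fin D2 → ℝ) :
    Omega d1 β ηenc ηdec θ * (Omega d1 β ηenc ηdec θ)ᵀ
      = diagonal fun i : Fin D2 => (if (i : ℕ) < d1 then omega β ηenc ηdec (θ i) else 0) ^ 2 := by
  ext i i'
  rw [Omega_eq, mul_apply, diagonal_apply]
  simp only [of_apply, transpose_apply]
  by_cases hi : (i : ℕ) < d1
  · rw [Finset.sum_eq_single ⟨i, hi⟩]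
    · by_cases h : i = i'
      · subst h
        simp [hi, sq]
      · have h' : (i' : ℕ) ≠ i := fun h' => h (Fin.ext h'.symm)
        simp [h, h']
    · intro j _ hj
      rw [if_neg fun h => hj (Fin.ext h.symm), zero_mul]
    · simp
  · rw [Finset.sum_eq_zero]
    · simp [hi]
    · intro j _
      rw [if_neg fun h : (i : ℕ) = j => hi (h ▸ j.2), zero_mul]

theorem Omega_transpose_mul (hβ : 0 < β) {D2 : ℕ} (d1 : ℕ) (θ : Fin D2 → ℝ) :
    (Omega d1 β ηenc ηdec θ)ᵀ * Omega d1 β ηenc ηdec θ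
      = diagonal fun j : Fin d1 => omega β ηenc ηdec (extend θ j) ^ 2 := by
  ext j j'
  rw [mul_apply, diagonal_apply]
  simp only [Omega, of_apply, transpose_apply]
  by_cases hj : (j : ℕ) < D2
  · rw [Finset.sum_eq_single ⟨j, hj⟩]
    · by_cases h : j = j'
      · subst h
        simp [sq]
      · have h' : (j : ℕ) ≠ j' := fun h' => h (Fin.ext h')
        simp [h, h']
    · intro i _ hi
      rw [if_neg fun h => hi (Fin.ext h), zero_mul]
    · simp
  · rw [Finset.sum_eq_zero]
    · have : extend θ j = 0 := dif_neg hj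
      simp [this, omega_eq_zero hβ]
    · intro i _
      rw [if_neg fun h : (i : ℕ) = j => hj (h ▸ i.2), zero_mul]

theorem isOrthDiag_mul_transpose_of_eq (hβ : 0 < β) (hηenc : 0 < ηenc) (hηdec : 0 < ηdec)
    {D2 d1 : ℕ} {θ : Fin D2 → ℝ} {P : Matrix (Fin D2) (Fin D2) ℝ}
    (hP : P ∈ Matrix.orthogonalGroup (Fin D2) ℝ) {R : Matrix (Fin d1) (Fin d1) ℝ}
    (hR : R ∈ Matrix.orthogonalGroup (Fin d1) ℝ) {U : Matrix (Fin D2) (Fin d1) ℝ}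
    (hU : U = P * Omega d1 β ηenc ηdec θ * Rᵀ) :
    IsOrthDiag (U * Uᵀ) P fun i => if (i : ℕ) < d1 then
      gainArg (β * ηdec ^ 2) (β * (ηdec / ηenc) ^ 2) (θ i) else 0 := by
  refine ⟨hP, ?_⟩
  have h1 : (fun i : Fin D2 => if (i : ℕ) < d1 then
      gainArg (β * ηdec ^ 2) (β * (ηdec / ηenc) ^ 2) (θ i) else 0)
      = fun i : Fin D2 => (if (i : ℕ) < d1 then omega β ηenc ηdec (θ i) else 0) ^ 2 := by
    funext i
    split_ifs
    · rw [omega_sq hβ hηenc hηdec]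
    · simp
  rw [h1, ← Omega_mul_transpose, hU]
  simp only [transpose_mul, transpose_transpose, Matrix.mul_assoc]
  rw [orth_transpose_mul_cancel hR]

theorem isOrthDiag_transpose_mul_of_eq (hβ : 0 < β) (hηenc : 0 < ηenc) (hηdec : 0 < ηdec)
    {D2 d1 : ℕ} {θ : Fin D2 → ℝ} {P : Matrix (Fin D2) (Fin D2) ℝ}
    (hP : P ∈ Matrix.orthogonalGroup (Fin D2) ℝ) {R : Matrix (Fin d1) (Fin d1) ℝ}
    (hR : R ∈ Matrix.orthogonalGroup (Fin d1) ℝ) {U : Matrix (Fin D2) (Fin d1) ℝ}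
    (hU : U = P * Omega d1 β ηenc ηdec θ * Rᵀ) :
    IsOrthDiag (Uᵀ * U) R fun j => gainArg (β * ηdec ^ 2) (β * (ηdec / ηenc) ^ 2) (extend θ j) := by
  refine ⟨hR, ?_⟩
  simp only [← omega_sq hβ hηenc hηdec]
  rw [← Omega_transpose_mul hβ, hU]
  simp only [transpose_mul, transpose_transpose, Matrix.mul_assoc]
  rw [orth_transpose_mul_cancel hP]

theorem exists_eq_of_isOrthDiag_mul_transpose (hβ : 0 < β) (hηenc : 0 < ηenc) (hηdec : 0 < ηdec)
    {D2 d1 : ℕ} {θ : Fin D2 → ℝ} {P : Matrix (Fin D2) (Fin D2) ℝ} {U : Matrix (Fin D2) (Fin d1) ℝ}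
    (h : IsOrthDiag (U * Uᵀ) P fun i => if (i : ℕ) < d1 then
      gainArg (β * ηdec ^ 2) (β * (ηdec / ηenc) ^ 2) (θ i) else 0) :
    ∃ R ∈ Matrix.orthogonalGroup (Fin d1) ℝ, U = P * Omega d1 β ηenc ηdec θ * Rᵀ := by
  have h1 := h.transpose_mul_mul
  obtain ⟨R, hR, hK⟩ := exists_orth_of_mul_transpose (K := Pᵀ * U)
    (w := fun i : Fin D2 => if (i : ℕ) < d1 then omega β ηenc ηdec (θ i) else 0)
    (fun i hi => if_neg (not_lt.2 hi)) (by
      rw [transpose_mul, transpose_transpose, Matrix.mul_assoc, ← Matrix.mul_assoc U,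
        ← Matrix.mul_assoc, h1]
      congr 1
      funext i
      split_ifs
      · rw [omega_sq hβ hηenc hηdec]
      · simp)
  refine ⟨R, hR, ?_⟩
  rw [Matrix.mul_assoc, Omega_eq, ← hK, orth_mul_cancel h.1]

/-- These are the eigenvalues κ/(ω² + l) of the optimal encoder variance; ω² + l equals t/ηenc²
above the threshold and `l` below it. -/
theorem sigma_sq (hβ : 0 < β) (hηenc : 0 < ηenc) (hηdec : 0 < ηdec) (t : ℝ) :
    sigma β ηenc ηdec t ^ 2 = β * ηdec ^ 2 /
      (gainArg (β * ηdec ^ 2) (β * (ηdec / ηenc) ^ 2) t + β * (ηdec / ηenc) ^ 2) := by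
  have hκ : 0 < β * ηdec ^ 2 := by positivity
  by_cases h : β * ηdec ^ 2 ≤ t
  · have ht : 0 < t := hκ.trans_le h
    rw [sigma, if_pos h, gainArg, max_eq_right (sub_nonneg.2 h), div_pow, mul_pow, mul_pow,
      Real.sq_sqrt hβ.le, Real.sq_sqrt ht.le]
    have : β * (ηdec / ηenc) ^ 2 / (β * ηdec ^ 2) * (t - β * ηdec ^ 2) + β * (ηdec / ηenc) ^ 2
        = t / ηenc ^ 2 := by
      field_simp
      ring
    rw [this]
    field_simp
  · rw [sigma, if_neg h, gainArg_eq_zero (not_le.1 h).le]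
    field_simp
    simp

theorem sigma_nonneg (hηenc : 0 < ηenc) (hηdec : 0 < ηdec) (t : ℝ) :
    0 ≤ sigma β ηenc ηdec t := by
  unfold sigma
  split_ifs
  · positivity
  · exact hηenc.le

/-! ### The global minimum -/

/-- The minimal value of the objective, times `ηdec ^ 2`. -/
def minValue {D2 : ℕ} (d1 : ℕ) (κ l : ℝ) (θ : Fin D2 → ℝ) : ℝ :=
  κ * d1 - κ * (d1 * Real.log κ) + (reducedConst d1 κ l θ - totalGain d1 κ θ)

variable {D2 d0 d1 d2 : ℕ} {D : Matrix (Fin D2) (Fin d2) ℝ} {Z : Matrix (Fin d0) (Fin d2) ℝ}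
  {P : Matrix (Fin D2) (Fin D2) ℝ} {θ : Fin D2 → ℝ}

theorem minValue_le (hβ : 0 < β) (hηenc : 0 < ηenc) (hηdec : 0 < ηdec)
    (hM : (1 - Zᵀ * Z).PosSemidef) (hE : IsOrderedEigenDecomp (D * (1 - Zᵀ * Z) * Dᵀ) P θ)
    (U1 : Matrix (Fin D2) (Fin d1) ℝ) (V1 : Matrix (Fin d1) (Fin d0) ℝ)
    (V2 : Matrix (Fin d1) (Fin d2) ℝ) (T2 : Matrix (Fin D2) (Fin d0) ℝ)
    {Sig : Matrix (Fin d1) (Fin d1) ℝ} (hS : Sig.PosDef) :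
    minValue d1 (β * ηdec ^ 2) (β * (ηdec / ηenc) ^ 2) θ
      ≤ ηdec ^ 2 * loss β ηenc ηdec D Z U1 V1 V2 T2 Sig := by
  obtain ⟨N, hN⟩ := exists_mul_transpose_eq hM
  have hκ : 0 < β * ηdec ^ 2 := by positivity
  have hl : 0 < β * (ηdec / ηenc) ^ 2 := by positivity
  rw [loss_eq hβ hηenc hηdec hN U1 V1 V2 T2 Sig rfl, minValue]
  have h1 := reduced_ge hκ hl hE U1
  have h2 := (trace_sub_log_det_ge hκ (regGram_posDef hl U1) hS).1
  rw [reduced] at h1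
  have h3 := frobSq_nonneg (U1 * (V1 + V2 * Zᵀ) + (T2 - D * Zᵀ))
  have h4 := mul_nonneg hl.le (frobSq_nonneg (V1 + V2 * Zᵀ))
  have h5 := frobSq_nonneg
    (U1 * (V2 * N - (regGram (β * (ηdec / ηenc) ^ 2) U1)⁻¹ * U1ᵀ * (D * N)))
  have h6 := mul_nonneg hl.le (frobSq_nonneg
    (V2 * N - (regGram (β * (ηdec / ηenc) ^ 2) U1)⁻¹ * U1ᵀ * (D * N)))
  linarith

/-- The excess over the minimum is a sum of nonnegative terms: the squares, the gap of `Sig` and the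
gap of `reduced`. It vanishes iff each of them does, and their equality cases are the listed
conditions. -/
theorem eq_minValue_iff (hβ : 0 < β) (hηenc : 0 < ηenc) (hηdec : 0 < ηdec)
    (hM : (1 - Zᵀ * Z).PosSemidef) (hE : IsOrderedEigenDecomp (D * (1 - Zᵀ * Z) * Dᵀ) P θ)
    (U1 : Matrix (Fin D2) (Fin d1) ℝ) (V1 : Matrix (Fin d1) (Fin d0) ℝ)
    (V2 : Matrix (Fin d1) (Fin d2) ℝ) (T2 : Matrix (Fin D2) (Fin d0) ℝ)
    (Sig : Matrix (Fin d1) (Fin d1) ℝ) :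
    (Sig.PosDef ∧ ηdec ^ 2 * loss β ηenc ηdec D Z U1 V1 V2 T2 Sig
        = minValue d1 (β * ηdec ^ 2) (β * (ηdec / ηenc) ^ 2) θ) ↔
      (∃ PE, IsOrderedEigenDecomp (D * (1 - Zᵀ * Z) * Dᵀ) PE θ ∧
        ∃ R ∈ Matrix.orthogonalGroup (Fin d1) ℝ, U1 = PE * Omega d1 β ηenc ηdec θ * Rᵀ) ∧
      T2 = D * Zᵀ ∧
      Sig = (β * ηdec ^ 2) • (regGram (β * (ηdec / ηenc) ^ 2) U1)⁻¹ ∧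
      V2 * (1 - Zᵀ * Z)
        = (regGram (β * (ηdec / ηenc) ^ 2) U1)⁻¹ * U1ᵀ * D * (1 - Zᵀ * Z) ∧
      V1 = -(V2 * Zᵀ) := by
  obtain ⟨N, hN⟩ := exists_mul_transpose_eq hM
  have hκ : 0 < β * ηdec ^ 2 := by positivity
  have hl : 0 < β * (ηdec / ηenc) ^ 2 := by positivity
  have hA := regGram_posDef hl U1
  rw [loss_eq hβ hηenc hηdec hN U1 V1 V2 T2 Sig rfl, minValue]
  constructor
  · rintro ⟨hS, heq⟩
    have h1 := reduced_ge hκ hl hE U1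
    obtain ⟨h2, h2'⟩ := trace_sub_log_det_ge hκ hA hS
    have h1' := exists_orderedEigenDecomp_of_reduced_eq hκ hl hE U1
    rw [reduced] at h1 h1'
    have h3 := frobSq_nonneg (U1 * (V1 + V2 * Zᵀ) + (T2 - D * Zᵀ))
    have h4 := mul_nonneg hl.le (frobSq_nonneg (V1 + V2 * Zᵀ))
    have h5 := frobSq_nonneg
      (U1 * (V2 * N - (regGram (β * (ηdec / ηenc) ^ 2) U1)⁻¹ * U1ᵀ * (D * N)))
    have h6 := mul_nonneg hl.le (frobSq_nonneg
      (V2 * N - (regGram (β * (ηdec / ηenc) ^ 2) U1)⁻¹ * U1ᵀ * (D * N)))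
    have e1 := frobSq_eq_zero (le_antisymm (by linarith) h3)
    have e2 := frobSq_eq_zero
      ((mul_eq_zero.1 (le_antisymm (by linarith) h4)).resolve_left hl.ne')
    have e3 := frobSq_eq_zero
      ((mul_eq_zero.1 (le_antisymm (by linarith) h6)).resolve_left hl.ne')
    obtain ⟨Q, hQ, hQU⟩ := h1' (by linarith)
    refine ⟨⟨Q, hQ, exists_eq_of_isOrthDiag_mul_transpose hβ hηenc hηdec hQU⟩, ?_,
      h2' (by linarith), ?_, eq_neg_of_add_eq_zero_left e2⟩
    · rw [e2, Matrix.mul_zero, zero_add] at e1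
      exact sub_eq_zero.1 e1
    · rw [← hN, ← Matrix.mul_assoc, sub_eq_zero.1 e3]
      simp only [Matrix.mul_assoc]
  · rintro ⟨⟨Q, hQ, R, hR, hU⟩, hT, hSig, hV2, hV1⟩
    refine ⟨hSig ▸ hA.inv.smul hκ, ?_⟩
    have e1 : V1 + V2 * Zᵀ = 0 := by rw [hV1, neg_add_cancel]
    have e2 : V2 * N - (regGram (β * (ηdec / ηenc) ^ 2) U1)⁻¹ * U1ᵀ * (D * N) = 0 := by
      -- `N` may be singular and cannot be cancelled, but X N Nᵀ = 0 gives ‖X N‖² = tr(X N Nᵀ Xᵀ) =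
      -- 0.
      apply frobSq_eq_zero
      have h1 : V2 * N - (regGram (β * (ηdec / ηenc) ^ 2) U1)⁻¹ * U1ᵀ * (D * N)
          = (V2 - (regGram (β * (ηdec / ηenc) ^ 2) U1)⁻¹ * U1ᵀ * D) * N := by
        rw [Matrix.sub_mul, ← Matrix.mul_assoc _ D N]
      rw [h1, frobSq_eq_trace', transpose_mul, ← Matrix.mul_assoc, Matrix.mul_assoc _ N, hN,
        Matrix.sub_mul, hV2, sub_self, Matrix.zero_mul, trace_zero]
    have e3 := reduced_eq_of_isOrthDiag (κ := β * ηdec ^ 2) hl hQ.isOrthDiag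
      (isOrthDiag_mul_transpose_of_eq hβ hηenc hηdec hQ.1 hR hU)
    rw [sum_gain_eq hκ hl, reduced] at e3
    have e4 := trace_sub_log_det_eq hκ hA
    rw [← hSig] at e4
    have f0 : ∀ m n : ℕ, frobSq (0 : Matrix (Fin m) (Fin n) ℝ) = 0 := by
      intro m n
      simp [frobSq]
    rw [e1, e2, hT, sub_self, Matrix.mul_zero, Matrix.mul_zero, add_zero, f0, f0, f0, f0]
    linarith

theorem exists_eq_minValue (hβ : 0 < β) (hηenc : 0 < ηenc) (hηdec : 0 < ηdec)
    (hM : (1 - Zᵀ * Z).PosSemidef) (hE : IsOrderedEigenDecomp (D * (1 - Zᵀ * Z) * Dᵀ) P θ) :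
    ∃ (U1 : Matrix (Fin D2) (Fin d1) ℝ) (V1 : Matrix (Fin d1) (Fin d0) ℝ)
      (V2 : Matrix (Fin d1) (Fin d2) ℝ) (T2 : Matrix (Fin D2) (Fin d0) ℝ)
      (Sig : Matrix (Fin d1) (Fin d1) ℝ),
      Sig.PosDef ∧ ηdec ^ 2 * loss β ηenc ηdec D Z U1 V1 V2 T2 Sig
        = minValue d1 (β * ηdec ^ 2) (β * (ηdec / ηenc) ^ 2) θ := by
  -- The factor R is the identity; the `rfl` proofs determine the other witnesses, with V2 the ridge
  -- solution itself.
  refine ⟨_, _, _, _, _, (eq_minValue_iff hβ hηenc hηdec hM hE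
    (P * Omega d1 β ηenc ηdec θ * (1 : Matrix (Fin d1) (Fin d1) ℝ)ᵀ) _ _ _ _).2
      ⟨⟨P, hE, 1, one_mem _, rfl⟩, rfl, rfl, rfl, rfl⟩⟩

theorem isGlobalMinimizer_iff_eq_minValue (hβ : 0 < β) (hηenc : 0 < ηenc) (hηdec : 0 < ηdec)
    (hM : (1 - Zᵀ * Z).PosSemidef) (hE : IsOrderedEigenDecomp (D * (1 - Zᵀ * Z) * Dᵀ) P θ)
    (U1 : Matrix (Fin D2) (Fin d1) ℝ) (V1 : Matrix (Fin d1) (Fin d0) ℝ)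
    (V2 : Matrix (Fin d1) (Fin d2) ℝ) (T2 : Matrix (Fin D2) (Fin d0) ℝ)
    (Sig : Matrix (Fin d1) (Fin d1) ℝ) :
    IsGlobalMinimizer β ηenc ηdec D Z U1 V1 V2 T2 Sig ↔
      Sig.PosDef ∧ ηdec ^ 2 * loss β ηenc ηdec D Z U1 V1 V2 T2 Sig
        = minValue d1 (β * ηdec ^ 2) (β * (ηdec / ηenc) ^ 2) θ := by
  have hη : 0 < ηdec ^ 2 := by positivity
  constructor
  · rintro ⟨hS, hmin⟩
    obtain ⟨U, V, V', T, S', hS', heq⟩ :=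
      exists_eq_minValue (d1 := d1) hβ hηenc hηdec hM hE
    refine ⟨hS, le_antisymm ?_ (minValue_le hβ hηenc hηdec hM hE U1 V1 V2 T2 hS)⟩
    rw [← heq]
    exact mul_le_mul_of_nonneg_left (hmin U V V' T S' hS') hη.le
  · rintro ⟨hS, heq⟩
    refine ⟨hS, fun U V V' T S' hS' => le_of_mul_le_mul_left ?_ hη⟩
    rw [heq]
    exact minValue_le hβ hηenc hηdec hM hE U V V' T hS'

end Parameters

/-! ### Rank, diagonal variances and collapsed columns -/

theorem pos_iff_lt_ncard {n : ℕ} {θ : Fin n → ℝ} (hθ : Antitone θ) (h0 : ∀ i, 0 ≤ θ i)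
    (i : Fin n) : 0 < θ i ↔ (i : ℕ) < {j | θ j ≠ 0}.ncard := by
  constructor
  · intro hi
    have hsub : ((Finset.Iic i : Finset (Fin n)) : Set (Fin n)) ⊆ {j | θ j ≠ 0} := fun j hj =>
      (hi.trans_le (hθ (Finset.mem_Iic.1 hj))).ne'
    have := Set.ncard_le_ncard hsub (Set.toFinite _)
    rwa [Set.ncard_coe_finset, Fin.card_Iic] at this
  · intro hi
    by_contra hpos
    have hzero := le_antisymm (not_lt.1 hpos) (h0 i)
    have hsub : {j | θ j ≠ 0} ⊆ ((Finset.Iio i : Finset (Fin n)) : Set (Fin n)) := by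
      intro j hj
      by_contra hji
      have hij : i ≤ j := not_lt.1 fun h => hji (Finset.mem_coe.2 (Finset.mem_Iio.2 h))
      exact hj (le_antisymm ((hθ hij).trans hzero.le) (h0 j))
    have := Set.ncard_le_ncard hsub (Set.toFinite _)
    rw [Set.ncard_coe_finset, Fin.card_Iio] at this
    omega

theorem gainArg_ne_zero_iff {κ l t : ℝ} (hκ : 0 < κ) (hl : 0 < l) : gainArg κ l t ≠ 0 ↔ κ < t :=
  ⟨lt_of_gainArg_ne_zero, fun h => by
    have := gainArg_lt hκ hl h h
    rw [gainArg_eq_zero le_rfl] at this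
    exact this.ne'⟩

theorem transpose_mul_self_apply_eq_zero {m n : ℕ} {U : Matrix (Fin m) (Fin n) ℝ} {j : Fin n} :
    (Uᵀ * U) j j = 0 ↔ ∀ i, U i j = 0 := by
  simp only [mul_apply, transpose_apply]
  rw [Finset.sum_eq_zero_iff_of_nonneg fun i _ => mul_self_nonneg _]
  simp

/-- If the regularized Gram matrix is diagonal, every column of `U` is either zero or contributes
to the rank. -/
theorem ncard_zero_columns_add_rank {m n : ℕ} {U : Matrix (Fin m) (Fin n) ℝ}
    (h : ∀ i j, i ≠ j → (Uᵀ * U) i j = 0) :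
    {j | ∀ i, U i j = 0}.ncard + U.rank = n := by
  have hd : Uᵀ * U = diagonal fun j => (Uᵀ * U) j j := by
    ext i j
    rw [diagonal_apply]
    split_ifs with hij
    · rw [hij]
    · exact h i j hij
  have hdiag : IsOrthDiag (Uᵀ * U) 1 fun j => (Uᵀ * U) j j :=
    ⟨one_mem _, by rw [Matrix.one_mul, transpose_one, Matrix.mul_one, ← hd]⟩
  rw [← rank_transpose_mul_self, hdiag.rank]
  simp only [← transpose_mul_self_apply_eq_zero]
  have := Set.ncard_add_ncard_compl {j | (Uᵀ * U) j j = 0}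
  rwa [Nat.card_fin] at this

/-- Comparing entries in AS = κI gives both `σ j ≠ 0` (on the diagonal) and the vanishing of `A` off
the diagonal, with no positivity of `σ` assumed. -/
theorem sq_mul_eq_of_eq_diagonal {n : ℕ} {A S : Matrix (Fin n) (Fin n) ℝ} {κ : ℝ} {σ : Fin n → ℝ}
    (hA : IsUnit A.det) (hS : S = κ • A⁻¹) (hσ : S = diagonal fun i => σ i ^ 2) (i j : Fin n) :
    A i j * σ j ^ 2 = if i = j then κ else 0 := by
  have : A * S = κ • 1 := by rw [hS, Matrix.mul_smul, mul_nonsing_inv A hA]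
  rw [hσ] at this
  have := congrFun (congrFun this i) j
  rwa [mul_diagonal, Matrix.smul_apply, one_apply, smul_eq_mul, mul_ite, mul_one, mul_zero] at this

theorem isOrthDiag_smul_inv {n : ℕ} {A R : Matrix (Fin n) (Fin n) ℝ} {κ : ℝ} {a : Fin n → ℝ}
    (hA : IsOrthDiag A R a) (ha : ∀ i, a i ≠ 0) :
    IsOrthDiag (κ • A⁻¹) R fun i => κ / a i := by
  refine isOrthDiag_of_mul_eq hA.1 ?_
  have hdet : IsUnit A.det := by
    rw [hA.det]
    exact (Finset.prod_ne_zero_iff.2 fun i _ => ha i).isUnit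
  have h1 : A⁻¹ * R = R * diagonal fun i => (a i)⁻¹ := by
    have h2 : R = A * (R * diagonal fun i => (a i)⁻¹) := by
      rw [← Matrix.mul_assoc, hA.mul_eq, Matrix.mul_assoc, diagonal_mul_diagonal]
      simp [ha]
    conv_lhs => rw [h2]
    rw [Matrix.nonsing_inv_mul_cancel_left _ _ hdet]
  rw [Matrix.smul_mul, h1]
  ext i j
  rw [Matrix.smul_apply, mul_diagonal, mul_diagonal, smul_eq_mul]
  ring

end LinearCVAE

end

/-! ### The main theorem -/

theorem theorem1 {S : Type*} [MeasurableSpace S] (μ : Measure S) [IsProbabilityMeasure μ]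
    {D0 D2 d0 d1 d2 : ℕ} (x : S → Fin D0 → ℝ) (y : S → Fin D2 → ℝ)
    (hx : MemLp x 2 μ) (hy : MemLp y 2 μ)
    (PA : Matrix (Fin D0) (Fin d0) ℝ) (φ : Fin d0 → ℝ)
    (PB : Matrix (Fin D2) (Fin d2) ℝ) (ψ : Fin d2 → ℝ)
    (hA : LinearCVAE.IsReducedEigenDecomp (LinearCVAE.crossMoment μ x x) PA φ)
    (hB : LinearCVAE.IsReducedEigenDecomp (LinearCVAE.crossMoment μ y y) PB ψ)
    (β ηenc ηdec : ℝ) (hβ : 0 < β) (hηenc : 0 < ηenc) (hηdec : 0 < ηdec)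
    (D : Matrix (Fin D2) (Fin d2) ℝ) (hD : D = LinearCVAE.scaledBasis PB ψ)
    (Z : Matrix (Fin d0) (Fin d2) ℝ)
    (hZ : Z = LinearCVAE.crossMoment μ (LinearCVAE.whiten PA φ x) (LinearCVAE.whiten PB ψ y))
    (E : Matrix (Fin D2) (Fin D2) ℝ) (hE : E = D * (1 - Zᵀ * Z) * Dᵀ) :
    -- an ordered eigenvalue decomposition and a global minimizer exist
    (∃ P θ, LinearCVAE.IsOrderedEigenDecomp E P θ) ∧
    (∃ (U1 : Matrix (Fin D2) (Fin d1) ℝ) (V1 : Matrix (Fin d1) (Fin d0) ℝ)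
      (V2 : Matrix (Fin d1) (Fin d2) ℝ) (T2 : Matrix (Fin D2) (Fin d0) ℝ)
      (Sig : Matrix (Fin d1) (Fin d1) ℝ),
      LinearCVAE.IsGlobalMinimizer β ηenc ηdec D Z U1 V1 V2 T2 Sig) ∧
    E.rank ≤ d2 ∧
    -- `θ` is the non-increasing sequence of the eigenvalues of `E`
    ∀ θ : Fin D2 → ℝ, (∃ P, LinearCVAE.IsOrderedEigenDecomp E P θ) →
      (∀ i, 0 ≤ θ i) ∧ (∀ i, 0 < θ i ↔ (i : ℕ) < E.rank) ∧
      ∀ (U1 : Matrix (Fin D2) (Fin d1) ℝ) (V1 : Matrix (Fin d1) (Fin d0) ℝ)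
        (V2 : Matrix (Fin d1) (Fin d2) ℝ) (T2 : Matrix (Fin D2) (Fin d0) ℝ)
        (Sig : Matrix (Fin d1) (Fin d1) ℝ),
        -- the global minimizers
        (LinearCVAE.IsGlobalMinimizer β ηenc ηdec D Z U1 V1 V2 T2 Sig ↔
          (∃ PE, LinearCVAE.IsOrderedEigenDecomp E PE θ ∧
            ∃ R ∈ Matrix.orthogonalGroup (Fin d1) ℝ,
              U1 = PE * LinearCVAE.Omega d1 β ηenc ηdec θ * Rᵀ) ∧
          T2 = D * Zᵀ ∧
          Sig = (β * ηdec ^ 2) • (U1ᵀ * U1 + (β * (ηdec / ηenc) ^ 2) • 1)⁻¹ ∧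
          V2 * (1 - Zᵀ * Z) =
            (U1ᵀ * U1 + (β * (ηdec / ηenc) ^ 2) • 1)⁻¹ * U1ᵀ * D * (1 - Zᵀ * Z) ∧
          V1 = -(V2 * Zᵀ)) ∧
        (LinearCVAE.IsGlobalMinimizer β ηenc ηdec D Z U1 V1 V2 T2 Sig →
          -- the rank of the optimal `U1`
          U1.rank = {i : Fin d1 | β * ηdec ^ 2 < LinearCVAE.extend θ i}.ncard ∧
          -- diagonal optimal encoder variances
          ∀ σ : Fin d1 → ℝ, (∀ i, 0 ≤ σ i) → Sig = Matrix.diagonal (fun i => σ i ^ 2) →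
            (∃ π : Equiv.Perm (Fin d1), ∀ i,
              σ (π i) = LinearCVAE.sigma β ηenc ηdec (LinearCVAE.extend θ i)) ∧
            {j : Fin d1 | ∀ i, U1 i j = 0}.ncard + U1.rank = d1) := by
  have hκ : 0 < β * ηdec ^ 2 := by positivity
  have hl : 0 < β * (ηdec / ηenc) ^ 2 := by positivity
  have hM := LinearCVAE.one_sub_posSemidef hx hy hA hB hZ
  have hEpos : E.PosSemidef := by
    have := hM.mul_mul_conjTranspose_same D
    rwa [conjTranspose_eq_transpose_of_trivial, ← hE] at this
  obtain ⟨P₀, θ₀, hE₀⟩ := LinearCVAE.exists_isOrderedEigenDecomp hEpos.1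
  refine ⟨⟨P₀, θ₀, hE₀⟩, ?_, ?_, ?_⟩
  · rw [hE] at hE₀
    obtain ⟨U1, V1, V2, T2, Sig, h⟩ :=
      LinearCVAE.exists_eq_minValue (d1 := d1) hβ hηenc hηdec hM hE₀
    exact ⟨U1, V1, V2, T2, Sig,
      (LinearCVAE.isGlobalMinimizer_iff_eq_minValue hβ hηenc hηdec hM hE₀ _ _ _ _ _).2 h⟩
  · rw [hE]
    exact (Matrix.rank_mul_le_left _ _).trans
      ((Matrix.rank_mul_le_left _ _).trans (Matrix.rank_le_width D))
  · rintro θ ⟨P, hP⟩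
    have hθ0 := hP.isOrthDiag.nonneg hEpos
    refine ⟨hθ0, fun i => ?_, fun U1 V1 V2 T2 Sig => ?_⟩
    · rw [hP.isOrthDiag.rank]
      exact LinearCVAE.pos_iff_lt_ncard hP.2.1 hθ0 i
    subst hE
    have hiff := (LinearCVAE.isGlobalMinimizer_iff_eq_minValue hβ hηenc hηdec hM hP
      U1 V1 V2 T2 Sig).trans (LinearCVAE.eq_minValue_iff hβ hηenc hηdec hM hP U1 V1 V2 T2 Sig)
    refine ⟨hiff, fun hmin => ?_⟩
    obtain ⟨⟨PE, hPE, R, hR, hU⟩, -, hSig, -, -⟩ := hiff.1 hmin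
    have hgram := LinearCVAE.isOrthDiag_transpose_mul_of_eq hβ hηenc hηdec hPE.1 hR hU
    refine ⟨?_, fun σ hσ0 hσ => ⟨?_, ?_⟩⟩
    · rw [← rank_transpose_mul_self, hgram.rank]
      simp only [LinearCVAE.gainArg_ne_zero_iff hκ hl]
    · have hreg : LinearCVAE.IsOrthDiag (LinearCVAE.regGram (β * (ηdec / ηenc) ^ 2) U1) R
          fun j => LinearCVAE.gainArg (β * ηdec ^ 2) (β * (ηdec / ηenc) ^ 2)
            (LinearCVAE.extend θ j) + β * (ηdec / ηenc) ^ 2 := by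
        refine LinearCVAE.isOrthDiag_of_mul_eq hR ?_
        rw [LinearCVAE.regGram, Matrix.add_mul, hgram.mul_eq, Matrix.smul_mul, Matrix.one_mul]
        ext i j
        simp only [Matrix.add_apply, mul_diagonal, Matrix.smul_apply, smul_eq_mul]
        ring
      have h1 := LinearCVAE.isOrthDiag_smul_inv (κ := β * ηdec ^ 2) hreg fun j =>
        (add_pos_of_nonneg_of_pos (LinearCVAE.gainArg_nonneg hκ hl) hl).ne'
      rw [← hSig] at h1
      -- The standard basis and `R` both diagonalize `Sig`, so the two lists of squares agree up to
      -- a permutation; nonnegativity removes the squares.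
      have h2 : LinearCVAE.IsOrthDiag Sig 1 fun i => σ i ^ 2 :=
        ⟨one_mem _, by rw [hσ, Matrix.one_mul, transpose_one, Matrix.mul_one]⟩
      obtain ⟨π, hπ⟩ := h2.exists_perm h1
      refine ⟨π, fun i => ?_⟩
      have h3 := congrFun hπ i
      simp only [Function.comp_apply, ← LinearCVAE.sigma_sq hβ hηenc hηdec] at h3
      exact (sq_eq_sq₀ (hσ0 _) (LinearCVAE.sigma_nonneg hηenc hηdec _)).1 h3
    · refine LinearCVAE.ncard_zero_columns_add_rank fun i j hij => ?_
      have hA' := LinearCVAE.isUnit_det_regGram hl U1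
      have h1 := LinearCVAE.sq_mul_eq_of_eq_diagonal hA' hSig hσ i j
      have h2 := LinearCVAE.sq_mul_eq_of_eq_diagonal hA' hSig hσ j j
      rw [if_pos rfl] at h2
      rw [if_neg hij] at h1
      have h3 := (mul_eq_zero.1 h1).resolve_right (right_ne_zero_of_mul (h2.trans_ne hκ.ne'))
      rw [LinearCVAE.regGram, Matrix.add_apply, Matrix.smul_apply, one_apply_ne hij,
        smul_zero, add_zero] at h3
      exact h3
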